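/- Let $\gamma_1,\gamma_2,\gamma_3>0$, $\Gamma=\mathrm{diag}(\gamma_1,\gamma_1,\gamma_1+\gamma_2+\gamma_3)$, and on $\mathfrak{gl}(3,\mathbb C)$ put $\langle A,B\rangle=\mathrm{Re}\,\mathrm{Tr}(A^*B)$ and $\langle\langle A,B\rangle\rangle=\mathrm{Re}\,\mathrm{Tr}(\Gamma A^*B)$. For $\mathbf w\in\mathbb R^3$ let $\widehat{\mathbf w}\in\mathfrak{so}(3)$ be the matrix of $\mathbf x\mapsto\mathbf w\times\mathbf x$. The group $U(1)\times SO(3)$ acts on the symmetric traceless complex $3\times3$ matrices by $A\mapsto e^{i\varphi}RAR^{-1}$. Let $\mathrm{Orb}(A_0)$ be the orbit through $$A_0=\begin{pmatrix}1&i&0\\ i&-1&0\\0&0&0\end{pmatrix}.$$ For $A\in\mathrm{Orb}(A_0)$ let $\mathbf J(A)$ be the $3\times 3$ matrix with entries $J_{ab}(A)=\langle\langle[A,\widehat{\mathbf e}_a],[A,\widehat{\mathbf e}_b]\rangle\rangle$, so that $l(\mathbf w,A):=\langle\langle[\widehat{\mathbf w},A],[\widehat{\mathbf w},A]\rangle\rangle=\mathbf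 w^\top\mathbf J(A)\mathbf w$. Identify the dual of the Lie algebra of $SO(3)\ltimes\mathfrak{gl}(3,\mathbb C)$ (where $SO(3)$ acts by conjugation) with $\mathbb R^3\times\mathfrak{gl}(3,\mathbb C)$ through the dot product and $\langle\cdot,\cdot\rangle$, with Lie–Poisson bracket $$\{f,g\}(\mathbf m,A)=\mathbf m\cdot\Big(\frac{\delta f}{\delta\mathbf m}\times\frac{\delta g}{\delta\mathbf m}\Big)+\Big\langle\frac{\delta g}{\delta A},\Big[A,\widehat{\frac{\delta f}{\delta\mathbf m}}\Big]\Big\rangle-\Big\langle\frac{\delta f}{\delta A},\Big[A,\widehat{\frac{\delta g}{\delta\mathbf m}}\Big]\Big\rangle .$$ **Theorem 4.11** ($\Omega_6$-phase). 1. $\mathrm{Orb}(A_0)=\{(\mathbf x+i\mathbf y)(\mathbf x+i\mathbf y)^\top : \mathbf x,\mathbf y\in\mathbb R^3,\ \|\mathbf x\|=\|\mathbf y\|=1,\ \mathbf x\cdot\mathbf y=0\}$, it consists of symmetric traceless matrices, and $R\mapsto RA_0R^{-1}$ induces a diffeomorphism $SO(3)/\mathbb Z_2\to\mathrm{Orb}(A_0)$,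 where $\mathbb Z_2=\{I,\mathrm{diag}(-1,-1,1)\}$. 2. The coadjoint orbit of $SO(3)\ltimes\mathfrak{gl}(3,\mathbb C)$ through $(0,A_0)$ is $P=\mathfrak{so}(3)^*\times\mathrm{Orb}(A_0)$. It is a six-dimensional submanifold on which the Lie–Poisson bracket is nondegenerate (symplectic). 3. For every $A\in\mathrm{Orb}(A_0)$ the matrix $\mathbf J(A)$ is invertible. With $\mathbf w:=\frac12\mathbf J(A)^{-1}\mathbf m$, the three functions $$h(\mathbf m,A)=\mathbf m\cdot\mathbf w-l(\mathbf w,A)=\tfrac14\mathbf m^\top\mathbf J(A)^{-1}\mathbf m,\qquad j_m(\mathbf m,A)=2\langle[\widehat{\mathbf w},A]\Gamma,iA\rangle,\qquad \mathbf J_3(\mathbf m,A)=\mathbf e_3\cdot\mathbf m$$ form a completely integrable system on $P$: they are smooth, they Poisson-commute pairwise, and their differentials along $P$ are linearly independent at every point of $P$ outside a set of measure zero. -/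

import Mathlib

open Matrix
open scoped ContDiff

-- Finite-dimensional matrix spaces carry the entrywise sup norm. Smoothness and derivatives do not
-- depend on this choice.
attribute [local instance] Matrix.normedAddCommGroup Matrix.normedSpace

noncomputable section

namespace Omega6

/-! ### Embedded submanifolds of normed spaces -/

section Submanifold

variable {E F : Type*} [NormedAddCommGroup E] [NormedSpace ℝ E]
  [NormedAddCommGroup F] [NormedSpace ℝ F]

/-- A map defined on a subset `S` of a normed space is smooth if locally around each point of `S`
it is the restriction of a smooth map defined on an open set of the ambient space. -/
def SmoothOnSubset (S : Set E) (f : E → F) : Prop :=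
  ∀ p ∈ S, ∃ (U : Set E) (g : E → F), IsOpen U ∧ p ∈ U ∧ ContDiffOn ℝ ∞ g U ∧
    ∀ q ∈ S ∩ U, f q = g q

/-- `φ : W → S ∩ U` is a smooth local parametrization of `S` by an open set `W` of `ℝ^d`:
a bijection of `W` onto the relatively open set `S ∩ U`, smooth as a map into the ambient space,
with inverse the restriction of the smooth map `ψ : U → ℝ^d`. -/
structure IsLocalParam (S : Set E) (d : ℕ) (φ : (Fin d → ℝ) → E) (W : Set (Fin d → ℝ))
    (ψ : E → (Fin d → ℝ)) (U : Set E) : Prop where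
  isOpen_source : IsOpen W
  isOpen_target : IsOpen U
  smooth : ContDiffOn ℝ ∞ φ W
  smooth_inv : ContDiffOn ℝ ∞ ψ U
  mapsTo : Set.MapsTo φ W (S ∩ U)
  mapsTo_inv : Set.MapsTo ψ (S ∩ U) W
  left_inv : Set.LeftInvOn ψ φ W
  right_inv : Set.LeftInvOn φ ψ (S ∩ U)

/-- `S` is a smooth embedded `d`-dimensional submanifold: each point of `S` has a neighbourhood
in `S` that is diffeomorphic to an open subset of `ℝ^d`. -/
def IsSubmanifold (S : Set E) (d : ℕ) : Prop :=
  ∀ p ∈ S, ∃ φ W ψ U, IsLocalParam S d φ W ψ U ∧ p ∈ U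

/-- `N` has measure zero in the `d`-dimensional submanifold `S`: around every point of `S` there is
a smooth local parametrization in which `N` corresponds to a Lebesgue null set of `ℝ^d`. -/
def IsNullIn (S : Set E) (d : ℕ) (N : Set E) : Prop :=
  ∀ p ∈ S, ∃ φ W ψ U, IsLocalParam S d φ W ψ U ∧ p ∈ U ∧
    MeasureTheory.volume (W ∩ φ ⁻¹' N) = 0

/-- The vectors tangent to `S` at `p`: velocities at `p` of curves in `S`. -/
def tangentVectors (S : Set E) (p : E) : Set E :=
  {v | ∃ γ : ℝ → E, γ 0 = p ∧ HasDerivAt γ v 0 ∧ ∀ᶠ t in nhds (0 : ℝ), γ t ∈ S}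

/-- The differentials at `p` of the restrictions to `S` of `f 0, …, f (k-1)` are linearly
independent as linear forms on the tangent space of `S` at `p`. -/
def DifferentialsIndependentAt (S : Set E) {k : ℕ} (f : Fin k → E → ℝ) (p : E) : Prop :=
  ∀ c : Fin k → ℝ, (∀ v ∈ tangentVectors S p, ∑ i, c i * fderiv ℝ (f i) p v = 0) → c = 0

end Submanifold

/-! ### Matrices and the order parameter -/

/-- `gl(3, ℂ)`, viewed as a real vector space. -/
abbrev GL3C := Matrix (Fin 3) (Fin 3) ℂ

/-- The rotation group `SO(3)`. -/
abbrev SO3 := Matrix.specialOrthogonalGroup (Fin 3) ℝ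

/-- A rotation, viewed as a complex matrix. -/
def toC (R : SO3) : GL3C := (R : Matrix (Fin 3) (Fin 3) ℝ).map Complex.ofReal

/-- The action `A ↦ R A R⁻¹` of `SO(3)`. -/
def conjBy (R : SO3) (A : GL3C) : GL3C := toC R * A * toC R⁻¹

/-- The symmetric traceless complex matrices. -/
def symTraceless : Set GL3C := {A | Aᵀ = A ∧ A.trace = 0}

/-- The hat map `ℝ³ ≅ so(3)`, `hat w x = w × x`, with values regarded as complex matrices. -/
def hat (w : Fin 3 → ℝ) : GL3C :=
  (!![0, -w 2, w 1; w 2, 0, -w 0; -w 1, w 0, 0] : Matrix (Fin 3) (Fin 3) ℝ).map Complex.ofReal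

/-- The inner product `⟨A, B⟩ = Re Tr (A* B)`. -/
def ip (A B : GL3C) : ℝ := (Aᴴ * B).trace.re

/-- The base point of the orbit. -/
def A₀ : GL3C := !![1, Complex.I, 0; Complex.I, -1, 0; 0, 0, 0]

/-- The orbit of `A₀` under the action `A ↦ e^{iφ} R A R⁻¹` of `U(1) × SO(3)`. -/
def orbit : Set GL3C := {A | ∃ (u : Circle) (R : SO3), A = (u : ℂ) • conjBy R A₀}

/-- The rotation `diag(-1, -1, 1)`. -/
def Jminus : SO3 :=
  ⟨Matrix.diagonal ![-1, -1, 1], by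
    rw [Matrix.mem_specialOrthogonalGroup_iff, Matrix.mem_orthogonalGroup_iff]
    constructor
    · ext i j
      fin_cases i <;> fin_cases j <;> simp [Matrix.diagonal_transpose]
    · simp [Matrix.det_diagonal, Fin.prod_univ_three]⟩

/-- The subgroup `ℤ₂ = {I, diag(-1, -1, 1)}` of `SO(3)`. -/
def Z2 : Subgroup SO3 := Subgroup.zpowers Jminus

/-- `e : SO(3)/ℤ₂ → S` is a diffeomorphism, for `S` a subset of `gl(3, ℂ)`. The smooth structure on
the quotient is the one for which `SO(3) → SO(3)/ℤ₂` is a local diffeomorphism: a map out of the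
quotient is smooth if its composition with the projection is smooth on `SO(3)`, and a map into the
quotient is smooth if it lifts locally to a smooth map into `SO(3)`. -/
structure IsDiffeoFromQuotient (S : Set GL3C) (e : (SO3 ⧸ Z2) ≃ S) : Prop where
  smooth : ∃ f : Matrix (Fin 3) (Fin 3) ℝ → GL3C,
    SmoothOnSubset (SO3 : Set (Matrix (Fin 3) (Fin 3) ℝ)) f ∧
      ∀ R : SO3, f R = e (QuotientGroup.mk R)
  smooth_inv : ∀ A : S, ∃ (U : Set GL3C) (σ : GL3C → Matrix (Fin 3) (Fin 3) ℝ),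
    IsOpen U ∧ (A : GL3C) ∈ U ∧ ContDiffOn ℝ ∞ σ U ∧
      ∀ B : S, (B : GL3C) ∈ U → ∃ R : SO3, σ B = R ∧ e.symm B = QuotientGroup.mk R

/-! ### The semidirect product `SO(3) ⋉ gl(3, ℂ)`, its coadjoint orbits and Lie–Poisson bracket -/

lemma toC_mul (R Q : SO3) : toC (R * Q) = toC R * toC Q := by
  simp only [toC, Submonoid.coe_mul]
  exact Matrix.map_mul (f := Complex.ofRealHom)

lemma toC_one : toC 1 = 1 := by
  simp [toC, Matrix.map_one]

lemma conjBy_mul (R Q : SO3) (A : GL3C) : conjBy (R * Q) A = conjBy R (conjBy Q A) := by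
  simp only [conjBy, _root_.mul_inv_rev, toC_mul, Matrix.mul_assoc]

lemma conjBy_one (A : GL3C) : conjBy 1 A = A := by
  simp [conjBy, toC_one]

lemma conjBy_add (R : SO3) (A B : GL3C) : conjBy R (A + B) = conjBy R A + conjBy R B := by
  simp [conjBy, Matrix.mul_add, Matrix.add_mul]

/-- `conjBy R` as an automorphism of the additive group `gl(3, ℂ)`. -/
def conjAddAut (R : SO3) : GL3C ≃+ GL3C where
  toFun := conjBy R
  invFun := conjBy R⁻¹
  left_inv A := by rw [← conjBy_mul, inv_mul_cancel, conjBy_one]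
  right_inv A := by rw [← conjBy_mul, mul_inv_cancel, conjBy_one]
  map_add' := conjBy_add R

/-- The representation of `SO(3)` on `gl(3, ℂ)` by conjugation, in the multiplicative notation
required by `SemidirectProduct`. -/
def conjHom : SO3 →* MulAut (Multiplicative GL3C) where
  toFun R := AddEquiv.toMultiplicative (conjAddAut R)
  map_one' := MulEquiv.ext fun A =>
    congrArg Multiplicative.ofAdd (conjBy_one (Multiplicative.toAdd A))
  map_mul' R Q := MulEquiv.ext fun A =>
    congrArg Multiplicative.ofAdd (conjBy_mul R Q (Multiplicative.toAdd A))

/-- The Lie group `SO(3) ⋉ gl(3, ℂ)`, with product `(v, R) (v', R') = (v + R v' R⁻¹, R R')`. -/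
abbrev SemiGroup := Multiplicative GL3C ⋊[conjHom] SO3

/-- The Lie algebra `so(3) ⋉ gl(3, ℂ)`, with `so(3) = ℝ³`; its dual is identified with the same
space by `pairing`, so that elements `(m, A)` of the dual have this type as well. -/
abbrev SemiAlg := (Fin 3 → ℝ) × GL3C

/-- The pairing `⟨(m, A), (ξ, u)⟩ = m ⬝ ξ + Re Tr (A* u)` of the dual of the Lie algebra with
the Lie algebra. -/
def pairing (μ X : SemiAlg) : ℝ := μ.1 ⬝ᵥ X.1 + ip μ.2 X.2

/-- The adjoint action `Ad_{(R, v)} (ξ, u) = (R ξ, R u R⁻¹ - [hat (R ξ), v])` of the group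
`SO(3) ⋉ gl(3, ℂ)`. -/
def Ad (s : SemiGroup) (X : SemiAlg) : SemiAlg :=
  ((s.right : Matrix (Fin 3) (Fin 3) ℝ) *ᵥ X.1,
    conjBy s.right X.2 -
      ⁅hat ((s.right : Matrix (Fin 3) (Fin 3) ℝ) *ᵥ X.1), Multiplicative.toAdd s.left⁆)

/-- The coadjoint orbit of `SO(3) ⋉ gl(3, ℂ)` through `μ`: the set of all `Ad*_{s⁻¹} μ`. -/
def coadjointOrbit (μ : SemiAlg) : Set SemiAlg :=
  {ν | ∃ s : SemiGroup, ∀ X, pairing ν X = pairing μ (Ad s⁻¹ X)}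

/-- The Lie–Poisson tensor at the point `p = (m, A)` evaluated at `X = (ξ, u)`, `Y = (η, v)`:
`m ⬝ (ξ × η) + ⟨v, [A, hat ξ]⟩ - ⟨u, [A, hat η]⟩`. -/
def poissonTensor (p X Y : SemiAlg) : ℝ :=
  p.1 ⬝ᵥ (crossProduct X.1 Y.1) + ip Y.2 ⁅p.2, hat X.1⁆ - ip X.2 ⁅p.2, hat Y.1⁆

/-- The functional derivative `(δf/δm, δf/δA)` at `p`, the gradient of `f` for `pairing`. -/
def funcDeriv (f : SemiAlg → ℝ) (p : SemiAlg) : SemiAlg :=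
  (fun i => fderiv ℝ f p (Pi.single i 1, 0),
    Matrix.of fun i j =>
      (⟨fderiv ℝ f p (0, Matrix.single i j 1), fderiv ℝ f p (0, Matrix.single i j Complex.I)⟩ : ℂ))

/-- The Lie–Poisson bracket. -/
def bracket (f g : SemiAlg → ℝ) (p : SemiAlg) : ℝ :=
  poissonTensor p (funcDeriv f p) (funcDeriv g p)

/-- The functions `f 0, …, f (n-1)`, given by formulas on a neighbourhood of `P`, form a completely
integrable system on the `2n`-dimensional submanifold `P` of the dual of the Lie algebra, with the
Poisson structure that the Lie–Poisson bracket induces on `P`. -/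
structure IsCompletelyIntegrable (P : Set SemiAlg) (n : ℕ) (f : Fin n → SemiAlg → ℝ) : Prop where
  submanifold : IsSubmanifold P (2 * n)
  /-- The kernel of the Poisson tensor at a point of `P` is the annihilator of the tangent space
  of `P`. So the bracket at points of `P` depends only on the restrictions of the functions to `P`,
  and the Poisson structure obtained in this way on `P` is nondegenerate (symplectic). -/
  symplectic : ∀ p ∈ P, ∀ X, (∀ Y, poissonTensor p X Y = 0) ↔
    ∀ v ∈ tangentVectors P p, pairing v X = 0
  smooth : ∀ i, ∀ p ∈ P, ContDiffAt ℝ ∞ (f i) p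
  involution : ∀ i j, ∀ p ∈ P, bracket (f i) (f j) p = 0
  independent : IsNullIn P (2 * n) {p ∈ P | ¬ DifferentialsIndependentAt P f p}

/-! ### The Lagrangian and the integrals -/

/-- `Γ = diag(γ₁, γ₁, γ₁ + γ₂ + γ₃)`. -/
def Gam (γ₁ γ₂ γ₃ : ℝ) : GL3C :=
  (Matrix.diagonal ![γ₁, γ₁, γ₁ + γ₂ + γ₃]).map Complex.ofReal

/-- The inner product `⟨⟨A, B⟩⟩ = Re Tr (Γ A* B)`. -/
def gip (γ₁ γ₂ γ₃ : ℝ) (A B : GL3C) : ℝ := (Gam γ₁ γ₂ γ₃ * Aᴴ * B).trace.re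

/-- The Lagrangian `l(w, A) = ⟨⟨[hat w, A], [hat w, A]⟩⟩`, i.e. the one-dimensional gradient energy
`Re Tr (Γ ∂A* ∂A)` with `∂A = [hat w, A]`. -/
def lagrangian (γ₁ γ₂ γ₃ : ℝ) (w : Fin 3 → ℝ) (A : GL3C) : ℝ :=
  gip γ₁ γ₂ γ₃ ⁅hat w, A⁆ ⁅hat w, A⁆

/-- The symmetric matrix `J(A)` of the quadratic form `l(·, A)`,
`J_ab(A) = ⟨⟨[A, hat e_a], [A, hat e_b]⟩⟩`. -/
def inertia (γ₁ γ₂ γ₃ : ℝ) (A : GL3C) : Matrix (Fin 3) (Fin 3) ℝ :=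
  Matrix.of fun a b =>
    gip γ₁ γ₂ γ₃ ⁅A, hat (Pi.single a 1)⁆ ⁅A, hat (Pi.single b 1)⁆

/-- The velocity `w = ½ J(A)⁻¹ m` with momentum `m = δl/δw = 2 J(A) w`. -/
def velocity (γ₁ γ₂ γ₃ : ℝ) (p : SemiAlg) : Fin 3 → ℝ :=
  (1 / 2 : ℝ) • ((inertia γ₁ γ₂ γ₃ p.2)⁻¹ *ᵥ p.1)

/-- The Hamiltonian `h(m, A) = m ⬝ w - l(w, A)`, where `w = ½ J(A)⁻¹ m`. -/
def hamiltonian (γ₁ γ₂ γ₃ : ℝ) (p : SemiAlg) : ℝ :=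
  p.1 ⬝ᵥ velocity γ₁ γ₂ γ₃ p - lagrangian γ₁ γ₂ γ₃ (velocity γ₁ γ₂ γ₃ p) p.2

/-- The momentum map `j_m = 2 ⟨(∂A) Γ, i A⟩` of the circle action `A ↦ e^{iφ} A`, expressed in
the variables `(m, A)` by `∂A = [hat w, A]`, `w = ½ J(A)⁻¹ m`. -/
def jm (γ₁ γ₂ γ₃ : ℝ) (p : SemiAlg) : ℝ :=
  2 * ip (⁅hat (velocity γ₁ γ₂ γ₃ p), p.2⁆ * Gam γ₁ γ₂ γ₃) (Complex.I • p.2)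

/-- `J₃(m, A) = e₃ ⬝ m`. -/
def J₃ (p : SemiAlg) : ℝ := p.1 2

end Omega6

end

open Omega6

noncomputable section

namespace Omega6

/-! ### Rotations -/

/-! Everything rests on the factorization `conjBy R A₀ = a aᵀ` with `a = frameVec R = R (e₁ + i
e₂)`. Rotating by θ about `e₃` before `R` multiplies `a` by a phase, so the circle action is
absorbed by rotations and the orbit is already an `SO(3)`-orbit. Since `a aᵀ` determines `a` up to
sign and `a` determines `R`, the stabilizer is ℤ₂. A complex square root recovers `a` smoothly near
`A₀`; translating by rotations gives local sections everywhere, and composing with the Cayley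
transform gives charts.

For `A` in the orbit the map `w ↦ [A, hat w]` is injective. Three facts follow. Its Gram matrix
`inertia` is invertible. Its adjoint `adjHat A` is onto ℝ³, so translations in the semidirect
product move the momentum freely and the coadjoint orbit is ℝ³ × orbit. For the same reason the
Hamiltonian vectors `ham p Y` fill the tangent space, so the kernel of the Poisson tensor is exactly
its annihilator.

Put `z = R e₃`. Because `i A = [A, hat (z/2)]`, the integral `jm` equals `-½ m · z` on the orbit
(`jm_eq`), and its Hamiltonian vector is `(0, iA)`, the generator of the circle action
(`ham_funcDeriv_jm`). The inertia matrix does not see the phase of `A`, so `h` commutes with `jm`.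
The vector of `J₃` generates rotations about `e₃`; these commute with Γ, whose first two diagonal
entries agree, so they preserve both `h` and `jm`.

For independence, variations of `m` alone suffice: the partial gradients are `½ J⁻¹ m`, `-½ z` and
`e₃`, independent as soon as `J⁻¹ m · (z × e₃) ≠ 0`. In a Cayley chart `z` is vertical only on a
null set, and for any other `z` the exceptional momenta form a plane, so Fubini shows that the
dependent set is null. -/

lemma coe_inv_SO3 (R : SO3) :
    ((R⁻¹ : SO3) : Matrix (Fin 3) (Fin 3) ℝ) = (R : Matrix (Fin 3) (Fin 3) ℝ)ᵀ := rfl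

lemma SO3_mul_transpose (R : SO3) :
    (R : Matrix (Fin 3) (Fin 3) ℝ) * (R : Matrix (Fin 3) (Fin 3) ℝ)ᵀ = 1 := by
  rw [← coe_inv_SO3, ← Submonoid.coe_mul, mul_inv_cancel]; rfl

lemma SO3_transpose_mul (R : SO3) :
    (R : Matrix (Fin 3) (Fin 3) ℝ)ᵀ * (R : Matrix (Fin 3) (Fin 3) ℝ) = 1 := by
  rw [← coe_inv_SO3, ← Submonoid.coe_mul, inv_mul_cancel]; rfl

lemma SO3_det (R : SO3) : (R : Matrix (Fin 3) (Fin 3) ℝ).det = 1 :=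
  (Matrix.mem_specialOrthogonalGroup_iff.1 R.2).2

lemma mem_SO3 {M : Matrix (Fin 3) (Fin 3) ℝ} (h : M * Mᵀ = 1) (hd : M.det = 1) :
    M ∈ Matrix.specialOrthogonalGroup (Fin 3) ℝ := by
  rw [Matrix.mem_specialOrthogonalGroup_iff, Matrix.mem_orthogonalGroup_iff]
  exact ⟨h, hd⟩

/-- A rotation equals its cofactor matrix. -/
lemma SO3_adjugate (R : SO3) :
    (R : Matrix (Fin 3) (Fin 3) ℝ).adjugate = (R : Matrix (Fin 3) (Fin 3) ℝ)ᵀ := by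
  have h := Matrix.mul_adjugate (R : Matrix (Fin 3) (Fin 3) ℝ)
  rw [SO3_det, one_smul] at h
  calc _ = ((R : Matrix (Fin 3) (Fin 3) ℝ)ᵀ * R) * (R : Matrix (Fin 3) (Fin 3) ℝ).adjugate := by
        rw [SO3_transpose_mul, one_mul]
    _ = _ := by rw [Matrix.mul_assoc, h, mul_one]

lemma SO3_cofactor (R : SO3) :
    R.1 0 0 = R.1 1 1 * R.1 2 2 - R.1 1 2 * R.1 2 1 ∧
    R.1 0 1 = R.1 1 2 * R.1 2 0 - R.1 1 0 * R.1 2 2 ∧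
    R.1 0 2 = R.1 1 0 * R.1 2 1 - R.1 1 1 * R.1 2 0 ∧
    R.1 1 0 = R.1 2 1 * R.1 0 2 - R.1 2 2 * R.1 0 1 ∧
    R.1 1 1 = R.1 2 2 * R.1 0 0 - R.1 2 0 * R.1 0 2 ∧
    R.1 1 2 = R.1 2 0 * R.1 0 1 - R.1 2 1 * R.1 0 0 ∧
    R.1 2 0 = R.1 0 1 * R.1 1 2 - R.1 0 2 * R.1 1 1 ∧
    R.1 2 1 = R.1 0 2 * R.1 1 0 - R.1 0 0 * R.1 1 2 ∧
    R.1 2 2 = R.1 0 0 * R.1 1 1 - R.1 0 1 * R.1 1 0 := by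
  have h := SO3_adjugate R
  rw [Matrix.adjugate_fin_three] at h
  have e := fun i j => congrFun (congrFun h i) j
  have h00 := e 0 0
  have h01 := e 0 1
  have h02 := e 0 2
  have h10 := e 1 0
  have h11 := e 1 1
  have h12 := e 1 2
  have h20 := e 2 0
  have h21 := e 2 1
  have h22 := e 2 2
  simp at h00 h01 h02 h10 h11 h12 h20 h21 h22
  refine ⟨?_, ?_, ?_, ?_, ?_, ?_, ?_, ?_, ?_⟩ <;> linarith

lemma SO3_rows (R : SO3) (i j : Fin 3) :
    R.1 i 0 * R.1 j 0 + R.1 i 1 * R.1 j 1 + R.1 i 2 * R.1 j 2 = if i = j then 1 else 0 := by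
  have h := congrFun (congrFun (SO3_mul_transpose R) i) j
  simpa [Matrix.mul_apply, Fin.sum_univ_three, Matrix.one_apply] using h

lemma SO3_cols (R : SO3) (i j : Fin 3) :
    R.1 0 i * R.1 0 j + R.1 1 i * R.1 1 j + R.1 2 i * R.1 2 j = if i = j then 1 else 0 := by
  have h := congrFun (congrFun (SO3_transpose_mul R) i) j
  simpa [Matrix.mul_apply, Fin.sum_univ_three, Matrix.one_apply] using h

lemma SO3_dot (R : SO3) (v w : Fin 3 → ℝ) : (R.1 *ᵥ v) ⬝ᵥ (R.1 *ᵥ w) = v ⬝ᵥ w := by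
  rw [Matrix.dotProduct_mulVec, Matrix.vecMul_mulVec, ← Matrix.dotProduct_mulVec,
    SO3_transpose_mul, Matrix.one_mulVec]

lemma SO3_dot_left (R : SO3) (v w : Fin 3 → ℝ) :
    (R.1 *ᵥ v) ⬝ᵥ w = v ⬝ᵥ ((R⁻¹ : SO3).1 *ᵥ w) := by
  rw [coe_inv_SO3, dotProduct_comm, Matrix.dotProduct_mulVec, Matrix.mulVec_transpose,
    dotProduct_comm]

lemma SO3_inv_mulVec_mulVec (R : SO3) (v : Fin 3 → ℝ) : (R⁻¹ : SO3).1 *ᵥ (R.1 *ᵥ v) = v := by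
  rw [Matrix.mulVec_mulVec, ← Submonoid.coe_mul, inv_mul_cancel]; exact Matrix.one_mulVec v

lemma SO3_mulVec_inv_mulVec (R : SO3) (v : Fin 3 → ℝ) : R.1 *ᵥ ((R⁻¹ : SO3).1 *ᵥ v) = v := by
  rw [Matrix.mulVec_mulVec, ← Submonoid.coe_mul, mul_inv_cancel]; exact Matrix.one_mulVec v

/-- Any matrix carries cross products to cross products through its cofactor matrix, which for a
rotation is the rotation itself. -/
lemma SO3_cross (R : SO3) (v w : Fin 3 → ℝ) :
    R.1 *ᵥ (crossProduct v w) = crossProduct (R.1 *ᵥ v) (R.1 *ᵥ w) := by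
  obtain ⟨h00, h01, h02, h10, h11, h12, h20, h21, h22⟩ := SO3_cofactor R
  ext i
  fin_cases i <;> simp [cross_apply, Matrix.mulVec, dotProduct, Fin.sum_univ_three]
  · rw [h00, h01, h02]; ring
  · rw [h10, h11, h12]; ring
  · rw [h20, h21, h22]; ring

/-! ### The hat map -/

/-- The real form of the hat map. -/
def hatR (w : Fin 3 → ℝ) : Matrix (Fin 3) (Fin 3) ℝ :=
  !![0, -w 2, w 1; w 2, 0, -w 0; -w 1, w 0, 0]

lemma hat_eq_map (w : Fin 3 → ℝ) : hat w = (hatR w).map Complex.ofReal := rfl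

lemma hatR_mulVec (w v : Fin 3 → ℝ) : hatR w *ᵥ v = crossProduct w v := by
  ext i
  fin_cases i <;> simp [hatR, cross_apply, Matrix.mulVec, dotProduct, Fin.sum_univ_three] <;> ring

lemma hatR_rot (R : SO3) (w : Fin 3 → ℝ) : hatR (R.1 *ᵥ w) = R.1 * hatR w * R.1ᵀ := by
  have h : hatR (R.1 *ᵥ w) * R.1 = R.1 * hatR w := by
    refine Matrix.toLin'.injective (LinearMap.ext fun v => ?_)
    rw [Matrix.toLin'_apply, Matrix.toLin'_apply, ← Matrix.mulVec_mulVec, ← Matrix.mulVec_mulVec,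
      hatR_mulVec, hatR_mulVec, SO3_cross]
  rw [← h, Matrix.mul_assoc, SO3_mul_transpose, mul_one]

lemma map_ofReal_mul (M N : Matrix (Fin 3) (Fin 3) ℝ) :
    (M * N).map Complex.ofReal = M.map Complex.ofReal * N.map Complex.ofReal :=
  Matrix.map_mul (f := Complex.ofRealHom)

lemma toC_inv (R : SO3) : toC R⁻¹ = (toC R)ᵀ := rfl

lemma toC_mul_inv (R : SO3) : toC R * toC R⁻¹ = 1 := by
  rw [← toC_mul, mul_inv_cancel, toC_one]

lemma toC_inv_mul (R : SO3) : toC R⁻¹ * toC R = 1 := by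
  rw [← toC_mul, inv_mul_cancel, toC_one]

lemma hat_rot (R : SO3) (w : Fin 3 → ℝ) : hat (R.1 *ᵥ w) = conjBy R (hat w) := by
  rw [hat_eq_map, hatR_rot, map_ofReal_mul, map_ofReal_mul]; rfl

lemma hat_add (v w : Fin 3 → ℝ) : hat (v + w) = hat v + hat w := by
  ext i j
  fin_cases i <;> fin_cases j <;> simp [hat] <;> ring

lemma hat_smul (c : ℝ) (w : Fin 3 → ℝ) : hat (c • w) = c • hat w := by
  ext i j
  fin_cases i <;> fin_cases j <;> simp [hat]

/-- The hat map as a linear map. -/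
def hatL : (Fin 3 → ℝ) →ₗ[ℝ] GL3C where
  toFun := hat
  map_add' := hat_add
  map_smul' := hat_smul

lemma conjBy_smul (R : SO3) (c : ℂ) (A : GL3C) : conjBy R (c • A) = c • conjBy R A := by
  simp [conjBy]

lemma conjBy_mul_mat (R : SO3) (A B : GL3C) : conjBy R (A * B) = conjBy R A * conjBy R B := by
  simp only [conjBy]
  calc toC R * (A * B) * toC R⁻¹ = toC R * A * 1 * B * toC R⁻¹ := by simp only [mul_one, mul_assoc]
    _ = _ := by rw [← toC_inv_mul R]; simp only [mul_assoc]

lemma conjBy_sub (R : SO3) (A B : GL3C) : conjBy R (A - B) = conjBy R A - conjBy R B := by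
  simp [conjBy, Matrix.mul_sub, Matrix.sub_mul]

lemma conjBy_bracket (R : SO3) (A B : GL3C) : conjBy R ⁅A, B⁆ = ⁅conjBy R A, conjBy R B⁆ := by
  simp only [Ring.lie_def, conjBy_sub, conjBy_mul_mat]

lemma conjBy_inv_conjBy (R : SO3) (A : GL3C) : conjBy R⁻¹ (conjBy R A) = A := by
  rw [← conjBy_mul, inv_mul_cancel, conjBy_one]

lemma conjBy_conjBy_inv (R : SO3) (A : GL3C) : conjBy R (conjBy R⁻¹ A) = A := by
  rw [← conjBy_mul, mul_inv_cancel, conjBy_one]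

lemma toC_conjTranspose (R : SO3) : (toC R)ᴴ = toC R⁻¹ := by
  rw [toC_inv]
  ext i j
  simp [toC]

lemma conjBy_conjTranspose (R : SO3) (A : GL3C) : (conjBy R A)ᴴ = conjBy R Aᴴ := by
  rw [conjBy, Matrix.conjTranspose_mul, Matrix.conjTranspose_mul, toC_conjTranspose,
    toC_conjTranspose, inv_inv, conjBy, Matrix.mul_assoc]

lemma trace_conjBy (R : SO3) (A : GL3C) : (conjBy R A).trace = A.trace := by
  rw [conjBy, Matrix.trace_mul_comm, ← Matrix.mul_assoc, toC_inv_mul, one_mul]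

lemma ip_conjBy (R : SO3) (A B : GL3C) : ip (conjBy R A) (conjBy R B) = ip A B := by
  rw [ip, conjBy_conjTranspose, ← conjBy_mul_mat, trace_conjBy, ip]

lemma gip_conjBy (γ₁ γ₂ γ₃ : ℝ) (R : SO3)
    (hR : conjBy R (Gam γ₁ γ₂ γ₃) = Gam γ₁ γ₂ γ₃) (A B : GL3C) :
    gip γ₁ γ₂ γ₃ (conjBy R A) (conjBy R B) = gip γ₁ γ₂ γ₃ A B := by
  rw [gip, conjBy_conjTranspose]
  nth_rw 1 [← hR]
  rw [← conjBy_mul_mat, ← conjBy_mul_mat, trace_conjBy, gip]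

end Omega6

end

noncomputable section

namespace Omega6

/-! ### The orbit -/

/-- The complex vector `R (e₁ + i e₂)`. -/
def frameVec (R : SO3) : Fin 3 → ℂ := fun k => (R.1 k 0 : ℂ) + Complex.I * (R.1 k 1 : ℂ)

lemma conjBy_A₀ (R : SO3) : conjBy R A₀ = Matrix.vecMulVec (frameVec R) (frameVec R) := by
  ext i j
  have e : ∀ i j, (R⁻¹ : SO3).1 i j = R.1 j i := fun _ _ => rfl
  simp only [conjBy, Matrix.mul_apply, Fin.sum_univ_three, A₀, toC, e, Matrix.map_apply,
    Matrix.vecMulVec_apply, frameVec]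
  simp
  linear_combination (-(R.1 i 1 : ℂ) * (R.1 j 1 : ℂ)) * Complex.I_mul_I

/-- A nonzero coordinate `a k` fixes the sign through `a k ^ 2 = b k ^ 2`; the products `a i * a k`
then fix all other coordinates. -/
lemma eq_or_eq_neg_of_vecMulVec_eq {n : Type*} {a b : n → ℂ}
    (h : Matrix.vecMulVec a a = Matrix.vecMulVec b b) : a = b ∨ a = -b := by
  have e : ∀ i j, a i * a j = b i * b j := fun i j => congrFun (congrFun h i) j
  by_cases ha : a = 0
  · left
    ext i
    have := e i i
    simpa [ha, eq_comm] using this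
  · obtain ⟨k, hk⟩ := Function.ne_iff.1 ha
    have hk' : a k ≠ 0 := hk
    rcases mul_self_eq_mul_self_iff.1 (e k k) with h1 | h1
    · left
      ext i
      apply mul_right_cancel₀ hk'
      rw [e i k, h1]
    · right
      ext i
      apply mul_right_cancel₀ hk'
      rw [e i k, h1]; simp

lemma frameVec_re (R : SO3) (k : Fin 3) : (frameVec R k).re = R.1 k 0 := by simp [frameVec]

lemma frameVec_im (R : SO3) (k : Fin 3) : (frameVec R k).im = R.1 k 1 := by simp [frameVec]

/-- The third column of a rotation is the cross product of the first two. -/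
lemma SO3_ext_of_cols {R Q : SO3} (h0 : ∀ k, R.1 k 0 = Q.1 k 0) (h1 : ∀ k, R.1 k 1 = Q.1 k 1) :
    R = Q := by
  obtain ⟨-, -, r0, -, -, r1, -, -, r2⟩ := SO3_cofactor R
  obtain ⟨-, -, q0, -, -, q1, -, -, q2⟩ := SO3_cofactor Q
  apply Subtype.ext
  ext i j
  fin_cases j
  · exact h0 i
  · exact h1 i
  · fin_cases i
    · show R.1 0 2 = Q.1 0 2
      rw [r0, q0]; simp only [h0, h1]
    · show R.1 1 2 = Q.1 1 2
      rw [r1, q1]; simp only [h0, h1]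
    · show R.1 2 2 = Q.1 2 2
      rw [r2, q2]; simp only [h0, h1]

lemma frameVec_injective : Function.Injective frameVec := fun R Q h =>
  SO3_ext_of_cols (fun k => by rw [← frameVec_re, h, frameVec_re])
    (fun k => by rw [← frameVec_im, h, frameVec_im])

lemma frameVec_mul_Jminus (R : SO3) : frameVec (R * Jminus) = -frameVec R := by
  ext k
  simp [frameVec, Jminus, Matrix.mul_apply, Matrix.diagonal]
  ring

lemma conjBy_A₀_eq_iff (R Q : SO3) :
    conjBy R A₀ = conjBy Q A₀ ↔ R = Q ∨ R = Q * Jminus := by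
  constructor
  · intro h
    rw [conjBy_A₀, conjBy_A₀] at h
    rcases eq_or_eq_neg_of_vecMulVec_eq h with h | h
    · exact Or.inl (frameVec_injective h)
    · rw [← frameVec_mul_Jminus] at h
      exact Or.inr (frameVec_injective h)
  · rintro (h | h)
    · rw [h]
    · rw [h, conjBy_A₀, conjBy_A₀, frameVec_mul_Jminus]
      ext i j
      simp [Matrix.vecMulVec_apply]

lemma Jminus_mul_self : Jminus * Jminus = 1 := by
  apply frameVec_injective
  rw [frameVec_mul_Jminus, ← one_mul Jminus, frameVec_mul_Jminus, neg_neg]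

lemma mem_Z2_iff (R : SO3) : R ∈ Z2 ↔ R = 1 ∨ R = Jminus := by
  constructor
  · rintro ⟨k, rfl⟩
    have h2 : Jminus ^ (2 : ℤ) = 1 := by rw [zpow_two, Jminus_mul_self]
    rcases Int.even_or_odd' k with ⟨n, rfl | rfl⟩
    · left
      simp [_root_.zpow_mul, h2]
    · right
      simp [_root_.zpow_add, _root_.zpow_mul, h2]
  · rintro (rfl | rfl)
    · exact Z2.one_mem
    · exact Subgroup.mem_zpowers _

lemma mk_eq_mk_iff (R Q : SO3) :
    (QuotientGroup.mk R : SO3 ⧸ Z2) = QuotientGroup.mk Q ↔ conjBy R A₀ = conjBy Q A₀ := by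
  rw [QuotientGroup.eq, mem_Z2_iff, eq_comm (a := conjBy R A₀), conjBy_A₀_eq_iff,
    inv_mul_eq_one, inv_mul_eq_iff_eq_mul, eq_comm (a := R)]

/-- The rotation by the angle `θ` about `e₃`. -/
def rotZ (θ : ℝ) : SO3 :=
  ⟨!![Real.cos θ, -Real.sin θ, 0; Real.sin θ, Real.cos θ, 0; 0, 0, 1], by
    apply mem_SO3
    · ext i j
      have := Real.sin_sq_add_cos_sq θ
      fin_cases i <;> fin_cases j <;>
        simp [Matrix.mul_apply, Fin.sum_univ_three] <;> linarith
    · have := Real.sin_sq_add_cos_sq θ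
      simp [Matrix.det_fin_three]
      linarith⟩

lemma frameVec_mul_rotZ (R : SO3) (θ : ℝ) :
    frameVec (R * rotZ θ) = Complex.exp (-θ * Complex.I) • frameVec R := by
  have h : Complex.exp (-θ * Complex.I) = Real.cos θ - Complex.I * Real.sin θ := by
    rw [Complex.exp_mul_I, Complex.cos_neg, Complex.sin_neg, Complex.ofReal_cos,
      Complex.ofReal_sin]
    ring
  ext k
  rw [Pi.smul_apply, h]
  simp only [frameVec, rotZ, Submonoid.coe_mul, Matrix.mul_apply, Fin.sum_univ_three]
  simp
  linear_combination (Complex.sin θ * (R.1 k 1 : ℂ)) * Complex.I_mul_I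

/-- The frame vector enters `a aᵀ` twice, so its phase is doubled. -/
lemma exp_smul_conjBy_A₀ (R : SO3) (θ : ℝ) :
    Complex.exp (-(2 * θ) * Complex.I) • conjBy R A₀ = conjBy (R * rotZ θ) A₀ := by
  rw [conjBy_A₀, conjBy_A₀, frameVec_mul_rotZ]
  have : Complex.exp (-(2 * θ) * Complex.I) =
      Complex.exp (-θ * Complex.I) * Complex.exp (-θ * Complex.I) := by
    rw [← Complex.exp_add]; ring_nf
  rw [this]
  ext i j
  simp [Matrix.vecMulVec_apply]
  ring

lemma mem_orbit_iff (A : GL3C) : A ∈ orbit ↔ ∃ R : SO3, A = conjBy R A₀ := by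
  constructor
  · rintro ⟨u, R, rfl⟩
    obtain ⟨t, rfl⟩ := Circle.exp_surjective u
    -- The angle solves `-2θ = t`, where `u = e^{it}`.
    refine ⟨R * rotZ (-t / 2), ?_⟩
    rw [← exp_smul_conjBy_A₀, Circle.coe_exp]
    congr 2
    push_cast
    ring
  · rintro ⟨R, rfl⟩
    exact ⟨1, R, by simp⟩

lemma conjBy_A₀_mem_orbit (R : SO3) : conjBy R A₀ ∈ orbit := (mem_orbit_iff _).2 ⟨R, rfl⟩

/-- The rotation with first two columns the orthonormal vectors `x`, `y`. -/
def rotOfCols (x y : Fin 3 → ℝ) (hx : x ⬝ᵥ x = 1) (hy : y ⬝ᵥ y = 1) (hxy : x ⬝ᵥ y = 0) : SO3 :=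
  ⟨(Matrix.of ![x, y, crossProduct x y])ᵀ, by
    have hz : crossProduct x y ⬝ᵥ crossProduct x y = 1 := by
      rw [cross_dot_cross, hx, hy, hxy]; simp
    apply mem_SO3
    -- In the order `Mᵀ * M` the entries are the dot products of the three columns.
    · rw [mul_eq_one_comm]
      ext i j
      have h1 := dot_self_cross x y
      have h2 := dot_cross_self x y
      have h3 : crossProduct x y ⬝ᵥ x = 0 := by rw [dotProduct_comm, h1]
      have h4 : crossProduct x y ⬝ᵥ y = 0 := by rw [dotProduct_comm, h2]
      have h5 : y ⬝ᵥ x = 0 := by rw [dotProduct_comm, hxy]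
      rw [Matrix.mul_apply]
      fin_cases i <;> fin_cases j <;> simpa [dotProduct] using by assumption
    · rw [Matrix.det_transpose]
      have := triple_product_eq_det x y (crossProduct x y)
      rw [triple_product_permutation, triple_product_permutation] at this
      exact this.symm.trans hz⟩

lemma orbit_eq : Omega6.orbit = {A | ∃ x y : Fin 3 → ℝ, x ⬝ᵥ x = 1 ∧ y ⬝ᵥ y = 1 ∧ x ⬝ᵥ y = 0 ∧
    A = Matrix.vecMulVec (fun k => (x k : ℂ) + Complex.I * (y k : ℂ))
      (fun k => (x k : ℂ) + Complex.I * (y k : ℂ))} := by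
  ext A
  rw [mem_orbit_iff, Set.mem_ofPred_eq]
  constructor
  · rintro ⟨R, rfl⟩
    refine ⟨fun k => R.1 k 0, fun k => R.1 k 1, ?_, ?_, ?_, conjBy_A₀ R⟩
    · simpa [dotProduct, Fin.sum_univ_three] using SO3_cols R 0 0
    · simpa [dotProduct, Fin.sum_univ_three] using SO3_cols R 1 1
    · simpa [dotProduct, Fin.sum_univ_three] using SO3_cols R 0 1
  · rintro ⟨x, y, hx, hy, hxy, rfl⟩
    exact ⟨rotOfCols x y hx hy hxy, (conjBy_A₀ (rotOfCols x y hx hy hxy)).symm⟩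

lemma orbit_subset_symTraceless : Omega6.orbit ⊆ symTraceless := by
  intro A hA
  obtain ⟨R, rfl⟩ := (mem_orbit_iff A).1 hA
  constructor
  · rw [conjBy_A₀]
    ext i j
    simp [Matrix.vecMulVec_apply, mul_comm]
  · rw [trace_conjBy]
    simp [A₀, Matrix.trace, Fin.sum_univ_three]

/-- The bijection `SO(3)/ℤ₂ → orbit` induced by `R ↦ R A₀ R⁻¹`. -/
def quotientEquiv : (SO3 ⧸ Z2) ≃ Omega6.orbit :=
  Equiv.ofBijective
    (Quotient.lift (fun R : SO3 => (⟨conjBy R A₀, conjBy_A₀_mem_orbit R⟩ : Omega6.orbit))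
      (fun R Q h => Subtype.ext ((mk_eq_mk_iff R Q).1 (Quotient.sound h))))
    (by
      constructor
      · intro a b
        refine Quotient.inductionOn₂ a b fun R Q h => ?_
        exact (mk_eq_mk_iff R Q).2 (congrArg Subtype.val h)
      · rintro ⟨A, hA⟩
        obtain ⟨R, rfl⟩ := (mem_orbit_iff A).1 hA
        exact ⟨QuotientGroup.mk R, rfl⟩)

lemma quotientEquiv_mk (R : SO3) :
    (quotientEquiv (QuotientGroup.mk R) : GL3C) = conjBy R A₀ := rfl

/-! ### The infinitesimal action and the inertia matrix -/

lemma hat_eq_sum (w : Fin 3 → ℝ) : hat w = w 0 • hat (Pi.single 0 1) +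
    w 1 • hat (Pi.single 1 1) + w 2 • hat (Pi.single 2 1) := by
  simp only [← hat_smul, ← hat_add]
  congr 1
  ext i
  fin_cases i <;> simp

lemma Gam_conjTranspose (γ₁ γ₂ γ₃ : ℝ) : (Gam γ₁ γ₂ γ₃)ᴴ = Gam γ₁ γ₂ γ₃ := by
  ext i j
  fin_cases i <;> fin_cases j <;> simp [Gam]

lemma gip_add_left (γ₁ γ₂ γ₃ : ℝ) (A B C : GL3C) :
    gip γ₁ γ₂ γ₃ (A + B) C = gip γ₁ γ₂ γ₃ A C + gip γ₁ γ₂ γ₃ B C := by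
  simp [gip, Matrix.mul_add, Matrix.add_mul]

lemma gip_smul_left (γ₁ γ₂ γ₃ : ℝ) (c : ℝ) (A C : GL3C) :
    gip γ₁ γ₂ γ₃ (c • A) C = c * gip γ₁ γ₂ γ₃ A C := by
  simp [gip]

lemma gip_comm (γ₁ γ₂ γ₃ : ℝ) (A B : GL3C) : gip γ₁ γ₂ γ₃ A B = gip γ₁ γ₂ γ₃ B A := by
  have h : (Gam γ₁ γ₂ γ₃ * Bᴴ * A) = (Aᴴ * B * Gam γ₁ γ₂ γ₃)ᴴ := by
    simp [Matrix.conjTranspose_mul, Gam_conjTranspose, Matrix.mul_assoc]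
  rw [gip, gip, h, Matrix.trace_conjTranspose, Matrix.trace_mul_comm _ (Gam γ₁ γ₂ γ₃),
    Matrix.mul_assoc]
  simp

lemma gip_add_right (γ₁ γ₂ γ₃ : ℝ) (A B C : GL3C) :
    gip γ₁ γ₂ γ₃ C (A + B) = gip γ₁ γ₂ γ₃ C A + gip γ₁ γ₂ γ₃ C B := by
  rw [gip_comm, gip_add_left, gip_comm, gip_comm γ₁ γ₂ γ₃ B]

lemma gip_smul_right (γ₁ γ₂ γ₃ : ℝ) (c : ℝ) (A C : GL3C) :
    gip γ₁ γ₂ γ₃ C (c • A) = c * gip γ₁ γ₂ γ₃ C A := by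
  rw [gip_comm, gip_smul_left, gip_comm]

lemma gip_one (A B : GL3C) : gip 1 0 0 A B = ip A B := by
  have : Gam 1 0 0 = 1 := by
    ext i j
    fin_cases i <;> fin_cases j <;> simp [Gam]
  rw [gip, this, one_mul, ip]

lemma gip_self (γ₁ γ₂ γ₃ : ℝ) (A : GL3C) : gip γ₁ γ₂ γ₃ A A =
    γ₁ * (Complex.normSq (A 0 0) + Complex.normSq (A 1 0) + Complex.normSq (A 2 0)) +
    γ₁ * (Complex.normSq (A 0 1) + Complex.normSq (A 1 1) + Complex.normSq (A 2 1)) +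
    (γ₁ + γ₂ + γ₃) *
      (Complex.normSq (A 0 2) + Complex.normSq (A 1 2) + Complex.normSq (A 2 2)) := by
  have h : Gam γ₁ γ₂ γ₃ = Matrix.diagonal ![(γ₁ : ℂ), γ₁, γ₁ + γ₂ + γ₃] := by
    ext i j
    fin_cases i <;> fin_cases j <;> simp [Gam]
  rw [gip, h, Matrix.mul_assoc]
  simp only [Matrix.trace, Matrix.diag_apply, Matrix.diagonal_mul, Fin.sum_univ_three]
  simp only [Matrix.mul_apply, Fin.sum_univ_three, Matrix.conjTranspose_apply]
  simp [Complex.normSq_apply]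

/-- Positivity is asked only of the diagonal entries of Γ, so that `γ = (1, 0, 0)` is allowed; this
case yields the corresponding facts about `ip`. -/
lemma eq_zero_of_gip_self {γ₁ γ₂ γ₃ : ℝ} (h₁ : 0 < γ₁) (h₂ : 0 < γ₁ + γ₂ + γ₃) {A : GL3C}
    (h : gip γ₁ γ₂ γ₃ A A = 0) : A = 0 := by
  rw [gip_self] at h
  have n := fun i j => Complex.normSq_nonneg (A i j)
  have a := fun i j => mul_nonneg h₁.le (n i j)
  have b := fun i j => mul_nonneg h₂.le (n i j)
  ext i j
  rw [Matrix.zero_apply, ← Complex.normSq_eq_zero]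
  have key : ∀ {c x : ℝ}, 0 < c → c * x = 0 → x = 0 := fun hc hx =>
    (mul_eq_zero.1 hx).resolve_left hc.ne'
  fin_cases j
  · apply key h₁
    fin_cases i <;> simp only [Fin.zero_eta, Fin.mk_one, Fin.reduceFinMk] <;>
      linarith [a 0 0, a 1 0, a 2 0, a 0 1, a 1 1, a 2 1, b 0 2, b 1 2, b 2 2]
  · apply key h₁
    fin_cases i <;> simp only [Fin.zero_eta, Fin.mk_one, Fin.reduceFinMk] <;>
      linarith [a 0 0, a 1 0, a 2 0, a 0 1, a 1 1, a 2 1, b 0 2, b 1 2, b 2 2]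
  · apply key h₂
    fin_cases i <;> simp only [Fin.zero_eta, Fin.mk_one, Fin.reduceFinMk] <;>
      linarith [a 0 0, a 1 0, a 2 0, a 0 1, a 1 1, a 2 1, b 0 2, b 1 2, b 2 2]

lemma bracket_hat_eq_sum (A : GL3C) (w : Fin 3 → ℝ) : ⁅A, hat w⁆ =
    w 0 • ⁅A, hat (Pi.single 0 1)⁆ + w 1 • ⁅A, hat (Pi.single 1 1)⁆ +
      w 2 • ⁅A, hat (Pi.single 2 1)⁆ := by
  rw [hat_eq_sum w]
  simp only [Ring.lie_def, Matrix.mul_add, Matrix.add_mul, Matrix.mul_smul, Matrix.smul_mul]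
  module

/-- This exhibits `inertia` as the Gram matrix of `w ↦ [A, hat w]`; later arguments use it in place
of matrix entries. -/
lemma dot_inertia (γ₁ γ₂ γ₃ : ℝ) (A : GL3C) (v w : Fin 3 → ℝ) :
    v ⬝ᵥ (inertia γ₁ γ₂ γ₃ A *ᵥ w) = gip γ₁ γ₂ γ₃ ⁅A, hat v⁆ ⁅A, hat w⁆ := by
  rw [bracket_hat_eq_sum A v, bracket_hat_eq_sum A w]
  simp only [gip_add_left, gip_add_right, gip_smul_left, gip_smul_right]
  simp only [dotProduct, Matrix.mulVec, Fin.sum_univ_three, inertia, Matrix.of_apply]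
  ring

lemma inertia_transpose (γ₁ γ₂ γ₃ : ℝ) (A : GL3C) :
    (inertia γ₁ γ₂ γ₃ A)ᵀ = inertia γ₁ γ₂ γ₃ A := by
  ext i j
  simp [inertia, gip_comm]

lemma inertia_conjBy (γ₁ γ₂ γ₃ : ℝ) (R : SO3)
    (hR : conjBy R (Gam γ₁ γ₂ γ₃) = Gam γ₁ γ₂ γ₃) (A : GL3C) :
    inertia γ₁ γ₂ γ₃ (conjBy R A) = R.1 * inertia γ₁ γ₂ γ₃ A * R.1ᵀ := by
  have key : ∀ v w, v ⬝ᵥ (inertia γ₁ γ₂ γ₃ (conjBy R A) *ᵥ w) =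
      v ⬝ᵥ ((R.1 * inertia γ₁ γ₂ γ₃ A * R.1ᵀ) *ᵥ w) := by
    intro v w
    have hv : ∀ u, ⁅conjBy R A, hat u⁆ = conjBy R ⁅A, hat ((R⁻¹ : SO3).1 *ᵥ u)⁆ := fun u => by
      rw [conjBy_bracket, ← hat_rot, SO3_mulVec_inv_mulVec]
    rw [dot_inertia, hv, hv, gip_conjBy _ _ _ _ hR, ← dot_inertia, SO3_dot_left, inv_inv,
      ← coe_inv_SO3, Matrix.mulVec_mulVec, Matrix.mulVec_mulVec, Matrix.mul_assoc]
  ext i j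
  have := key (Pi.single i 1) (Pi.single j 1)
  simpa using this

/-- Two entries suffice: the (0,2) entry is `w₁ - i w₀` and the (0,0) entry is `2 i w₂`. -/
lemma bracket_A₀_hat_eq_zero {w : Fin 3 → ℝ} (h : ⁅A₀, hat w⁆ = 0) : w = 0 := by
  have e := fun i j => congrFun (congrFun h i) j
  have h02 := congrArg Complex.re (e 0 2)
  have h02' := congrArg Complex.im (e 0 2)
  have h00 := congrArg Complex.im (e 0 0)
  simp only [Ring.lie_def, Matrix.sub_apply, Matrix.mul_apply, Fin.sum_univ_three, A₀, hat,
    Matrix.map_apply] at h02 h02' h00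
  simp at h02 h02' h00
  ext i
  fin_cases i <;> simp <;> linarith

lemma bracket_hat_eq_zero {A : GL3C} (hA : A ∈ Omega6.orbit) {w : Fin 3 → ℝ}
    (h : ⁅A, hat w⁆ = 0) : w = 0 := by
  obtain ⟨R, rfl⟩ := (mem_orbit_iff A).1 hA
  have h1 : ⁅A₀, hat ((R⁻¹ : SO3).1 *ᵥ w)⁆ = 0 := by
    rw [hat_rot]
    nth_rw 1 [← conjBy_inv_conjBy R A₀]
    rw [← conjBy_bracket, h]
    simp [conjBy]
  have h2 := bracket_A₀_hat_eq_zero h1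
  rw [← SO3_mulVec_inv_mulVec R w, h2, Matrix.mulVec_zero]

lemma inertia_det_ne_zero {γ₁ γ₂ γ₃ : ℝ} (h₁ : 0 < γ₁) (h₂ : 0 < γ₁ + γ₂ + γ₃) {A : GL3C}
    (hA : A ∈ Omega6.orbit) : (inertia γ₁ γ₂ γ₃ A).det ≠ 0 := by
  intro hd
  obtain ⟨w, hw, hw0⟩ := Matrix.exists_mulVec_eq_zero_iff.2 hd
  apply hw
  apply bracket_hat_eq_zero hA
  apply eq_zero_of_gip_self h₁ h₂
  rw [← dot_inertia, hw0, dotProduct_zero]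

end Omega6

end

noncomputable section

namespace Omega6

/-! ### Smoothness of matrix-valued maps -/

section Smooth

variable {E : Type*} [NormedAddCommGroup E] [NormedSpace ℝ E]

lemma contDiffAt_matrix {F : Type*} [NormedAddCommGroup F] [NormedSpace ℝ F]
    {f : E → Matrix (Fin 3) (Fin 3) F} {x : E}
    (h : ∀ i j, ContDiffAt ℝ ∞ (fun y => f y i j) x) : ContDiffAt ℝ ∞ f x :=
  contDiffAt_pi.2 fun i => contDiffAt_pi.2 fun j => h i j

lemma ContDiffAt.entry {F : Type*} [NormedAddCommGroup F] [NormedSpace ℝ F]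
    {f : E → Matrix (Fin 3) (Fin 3) F} {x : E} (h : ContDiffAt ℝ ∞ f x) (i j : Fin 3) :
    ContDiffAt ℝ ∞ (fun y => f y i j) x :=
  contDiffAt_pi.1 (contDiffAt_pi.1 h i) j

lemma ContDiffAt.matrix_mul {F : Type*} [NormedRing F] [NormedAlgebra ℝ F]
    {f g : E → Matrix (Fin 3) (Fin 3) F} {x : E} (hf : ContDiffAt ℝ ∞ f x)
    (hg : ContDiffAt ℝ ∞ g x) : ContDiffAt ℝ ∞ (fun y => f y * g y) x := by
  refine contDiffAt_matrix fun i j => ?_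
  simp only [Matrix.mul_apply, Fin.sum_univ_three]
  exact (((hf.entry i 0).mul (hg.entry 0 j)).add ((hf.entry i 1).mul (hg.entry 1 j))).add
    ((hf.entry i 2).mul (hg.entry 2 j))

lemma ContDiffAt.ofReal {f : E → ℝ} {x : E} (hf : ContDiffAt ℝ ∞ f x) :
    ContDiffAt ℝ ∞ (fun y => (f y : ℂ)) x :=
  Complex.ofRealCLM.contDiff.contDiffAt.comp x hf

lemma ContDiffAt.re {f : E → ℂ} {x : E} (hf : ContDiffAt ℝ ∞ f x) :
    ContDiffAt ℝ ∞ (fun y => (f y).re) x :=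
  Complex.reCLM.contDiff.contDiffAt.comp x hf

lemma ContDiffAt.im {f : E → ℂ} {x : E} (hf : ContDiffAt ℝ ∞ f x) :
    ContDiffAt ℝ ∞ (fun y => (f y).im) x :=
  Complex.imCLM.contDiff.contDiffAt.comp x hf

lemma ContDiffAt.conj {f : E → ℂ} {x : E} (hf : ContDiffAt ℝ ∞ f x) :
    ContDiffAt ℝ ∞ (fun y => star (f y)) x :=
  Complex.conjCLE.contDiff.contDiffAt.comp x hf

lemma ContDiffAt.conjBy (R : SO3) {f : E → GL3C} {x : E} (hf : ContDiffAt ℝ ∞ f x) :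
    ContDiffAt ℝ ∞ (fun y => conjBy R (f y)) x :=
  (contDiffAt_const.matrix_mul hf).matrix_mul contDiffAt_const

end Smooth

/-! ### The Cayley parametrization of rotations -/

/-- The entries of the Cayley transform of `hat v`, before normalization. -/
def cayNum (v : Fin 3 → ℝ) : Matrix (Fin 3) (Fin 3) ℝ :=
  !![1 + v 0 ^ 2 - v 1 ^ 2 - v 2 ^ 2, 2 * (v 0 * v 1 - v 2), 2 * (v 0 * v 2 + v 1);
    2 * (v 0 * v 1 + v 2), 1 - v 0 ^ 2 + v 1 ^ 2 - v 2 ^ 2, 2 * (v 1 * v 2 - v 0);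
    2 * (v 0 * v 2 - v 1), 2 * (v 1 * v 2 + v 0), 1 - v 0 ^ 2 - v 1 ^ 2 + v 2 ^ 2]

/-- `1 + ‖v‖²`. -/
def cayDen (v : Fin 3 → ℝ) : ℝ := 1 + v 0 ^ 2 + v 1 ^ 2 + v 2 ^ 2

lemma cayDen_pos (v : Fin 3 → ℝ) : 0 < cayDen v := by unfold cayDen; positivity

lemma cayNum_mul_transpose (v : Fin 3 → ℝ) :
    cayNum v * (cayNum v)ᵀ = (cayDen v ^ 2) • (1 : Matrix (Fin 3) (Fin 3) ℝ) := by
  ext i j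
  fin_cases i <;> fin_cases j <;>
    simp [cayNum, cayDen, Matrix.mul_apply, Fin.sum_univ_three] <;> ring

lemma cayNum_det (v : Fin 3 → ℝ) : (cayNum v).det = cayDen v ^ 3 := by
  simp [cayNum, cayDen, Matrix.det_fin_three]; ring

/-- The Cayley transform of `hat v`, a rotation. -/
def cay (v : Fin 3 → ℝ) : SO3 :=
  ⟨(cayDen v)⁻¹ • cayNum v, by
    have h := (cayDen_pos v).ne'
    apply mem_SO3
    · rw [Matrix.transpose_smul, Matrix.smul_mul, Matrix.mul_smul, cayNum_mul_transpose, smul_smul,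
        smul_smul]
      rw [show (cayDen v)⁻¹ * (cayDen v)⁻¹ * cayDen v ^ 2 = 1 by field_simp, one_smul]
    · rw [Matrix.det_smul, cayNum_det, Fintype.card_fin, ← mul_pow, inv_mul_cancel₀ h, one_pow]⟩

lemma cay_apply (v : Fin 3 → ℝ) (i j : Fin 3) : (cay v).1 i j = (cayDen v)⁻¹ * cayNum v i j := rfl

lemma contDiffAt_cay (v : Fin 3 → ℝ) : ContDiffAt ℝ ∞ (fun v => (cay v).1) v := by
  refine contDiffAt_matrix fun i j => ?_
  simp only [cay_apply]
  refine ContDiffAt.mul (ContDiffAt.inv ?_ (cayDen_pos v).ne') ?_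
  · unfold cayDen; fun_prop
  · fin_cases i <;> fin_cases j <;> simp [cayNum] <;> fun_prop

/-- The inverse of the Cayley parametrization. -/
def cayInv (M : Matrix (Fin 3) (Fin 3) ℝ) : Fin 3 → ℝ :=
  ![(M 2 1 - M 1 2) / (1 + M.trace), (M 0 2 - M 2 0) / (1 + M.trace),
    (M 1 0 - M 0 1) / (1 + M.trace)]

lemma one_add_trace_cay (v : Fin 3 → ℝ) : 1 + (cay v).1.trace = 4 / cayDen v := by
  have h := (cayDen_pos v).ne'
  simp only [Matrix.trace, Matrix.diag_apply, Fin.sum_univ_three, cay_apply]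
  field_simp
  simp [cayNum, cayDen]
  ring

lemma cayInv_cay (v : Fin 3 → ℝ) : cayInv (cay v).1 = v := by
  have h := (cayDen_pos v).ne'
  ext i
  fin_cases i <;> simp only [cayInv, one_add_trace_cay, cay_apply] <;> simp [cayNum] <;>
    field_simp <;> ring

/-- For angle θ about the unit axis `n`, the antisymmetric part of `R` encodes `2 sin θ n` and `1 +
tr R = 2 (1 + cos θ)`; their quotient `tan (θ/2) n` is the Cayley parameter. -/
lemma cay_cayInv (R : SO3) (h : 1 + R.1.trace ≠ 0) : cay (cayInv R.1) = R := by
  obtain ⟨h00, h01, h02, h10, h11, h12, h20, h21, h22⟩ := SO3_cofactor R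
  have r := fun i j => SO3_rows R i j
  have c := fun i j => SO3_cols R i j
  have r00 := r 0 0
  have r11 := r 1 1
  have r22 := r 2 2
  have c00 := c 0 0
  have c11 := c 1 1
  have c22 := c 2 2
  have r01 := r 0 1
  have r02 := r 0 2
  have r12 := r 1 2
  have c01 := c 0 1
  have c02 := c 0 2
  have c12 := c 1 2
  simp at r00 r11 r22 c00 c11 c22 r01 r02 r12 c01 c02 c12
  set s := 1 + R.1.trace with hs
  have hs' : s = 1 + R.1 0 0 + R.1 1 1 + R.1 2 2 := by
    rw [hs]; simp [Matrix.trace, Fin.sum_univ_three]; ring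
  have v0 : cayInv R.1 0 = (R.1 2 1 - R.1 1 2) / s := rfl
  have v1 : cayInv R.1 1 = (R.1 0 2 - R.1 2 0) / s := rfl
  have v2 : cayInv R.1 2 = (R.1 1 0 - R.1 0 1) / s := rfl
  -- Products of two antisymmetric entries are divisible by `s` modulo the orthogonality and
  -- cofactor relations. One factor `s` cancels, so all the quadratic terms of `cayNum` become
  -- linear in `R`, over `s`.
  have q00 : (R.1 2 1 - R.1 1 2) ^ 2 = s * (1 + R.1 0 0 - R.1 1 1 - R.1 2 2) := by
    rw [hs']; linear_combination r22 + r11 - c00 - 2 * h00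
  have q11 : (R.1 0 2 - R.1 2 0) ^ 2 = s * (1 - R.1 0 0 + R.1 1 1 - R.1 2 2) := by
    rw [hs']; linear_combination r00 + r22 - c11 - 2 * h11
  have q22 : (R.1 1 0 - R.1 0 1) ^ 2 = s * (1 - R.1 0 0 - R.1 1 1 + R.1 2 2) := by
    rw [hs']; linear_combination r11 + r00 - c22 - 2 * h22
  have q01 : (R.1 2 1 - R.1 1 2) * (R.1 0 2 - R.1 2 0) = s * (R.1 0 1 + R.1 1 0) := by
    rw [hs']; linear_combination -r01 - c01 - h01 - h10
  have q02 : (R.1 2 1 - R.1 1 2) * (R.1 1 0 - R.1 0 1) = s * (R.1 0 2 + R.1 2 0) := by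
    rw [hs']; linear_combination -r02 - c02 - h02 - h20
  have q12 : (R.1 0 2 - R.1 2 0) * (R.1 1 0 - R.1 0 1) = s * (R.1 1 2 + R.1 2 1) := by
    rw [hs']; linear_combination -r12 - c12 - h12 - h21
  have p00 : cayInv R.1 0 ^ 2 = (1 + R.1 0 0 - R.1 1 1 - R.1 2 2) / s := by
    rw [v0, div_pow, q00]; field_simp
  have p11 : cayInv R.1 1 ^ 2 = (1 - R.1 0 0 + R.1 1 1 - R.1 2 2) / s := by
    rw [v1, div_pow, q11]; field_simp
  have p22 : cayInv R.1 2 ^ 2 = (1 - R.1 0 0 - R.1 1 1 + R.1 2 2) / s := by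
    rw [v2, div_pow, q22]; field_simp
  have p01 : cayInv R.1 0 * cayInv R.1 1 = (R.1 0 1 + R.1 1 0) / s := by
    rw [v0, v1, div_mul_div_comm, q01]; field_simp
  have p02 : cayInv R.1 0 * cayInv R.1 2 = (R.1 0 2 + R.1 2 0) / s := by
    rw [v0, v2, div_mul_div_comm, q02]; field_simp
  have p12 : cayInv R.1 1 * cayInv R.1 2 = (R.1 1 2 + R.1 2 1) / s := by
    rw [v1, v2, div_mul_div_comm, q12]; field_simp
  have hd : cayDen (cayInv R.1) = 4 / s := by
    rw [cayDen, p00, p11, p22]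
    field_simp
    rw [hs']; ring
  apply Subtype.ext
  ext i j
  rw [cay_apply, hd]
  fin_cases i <;> fin_cases j <;> simp only [cayNum] <;> simp [p00, p11, p22, p01, p02, p12] <;>
    (try simp only [v0, v1, v2]) <;> field_simp <;> (try rw [hs']) <;> ring

lemma frameVec_sub_re (R : SO3) :
    (frameVec R 0 - Complex.I * frameVec R 1).re = R.1 0 0 + R.1 1 1 := by
  simp [frameVec]

/-! ### A local section of the orbit map -/

/-- The complex number whose square root determines the section near `A₀`. -/
def sqFun (B : GL3C) : ℂ := B 0 0 - Complex.I * B 0 1 - Complex.I * B 1 0 - B 1 1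

/-- A complex vector `a` with `B = a aᵀ`, for `B` in the orbit near `A₀`. -/
def liftVec (B : GL3C) (k : Fin 3) : ℂ := (B k 0 - Complex.I * B k 1) / sqFun B ^ (2⁻¹ : ℂ)

/-- The local section of `R ↦ R A₀ R⁻¹` near `A₀`. -/
def liftMat (B : GL3C) : Matrix (Fin 3) (Fin 3) ℝ :=
  (Matrix.of ![fun k => (liftVec B k).re, fun k => (liftVec B k).im,
    crossProduct (fun k => (liftVec B k).re) (fun k => (liftVec B k).im)])ᵀ

/-- `sqFun B` is the quadratic form of `B` at `e₁ - i e₂`, hence the square of a linear form in `a`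
when `B = a aᵀ`. Dividing `B (e₁ - i e₂)` by a root of it returns `±a`. -/
lemma sqFun_conjBy (R : SO3) :
    sqFun (conjBy R A₀) = (frameVec R 0 - Complex.I * frameVec R 1) ^ 2 := by
  rw [conjBy_A₀, sqFun]
  simp only [Matrix.vecMulVec_apply]
  linear_combination -(frameVec R 1 * frameVec R 1) * Complex.I_mul_I

lemma sq_mem_slitPlane {z : ℂ} (h : z.re ≠ 0) : z ^ 2 ∈ Complex.slitPlane := by
  rw [Complex.mem_slitPlane_iff]
  by_cases hi : z.im = 0
  · left
    simp [pow_two, hi]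
    positivity
  · right
    have : (z ^ 2).im = 2 * (z.re * z.im) := by simp [pow_two]; ring
    rw [this]
    exact mul_ne_zero two_ne_zero (mul_ne_zero h hi)

lemma re_ne_zero_of_sq_mem_slitPlane {z : ℂ} (h : z ^ 2 ∈ Complex.slitPlane) : z.re ≠ 0 := by
  intro h0
  rw [Complex.mem_slitPlane_iff] at h
  simp [pow_two, h0] at h
  nlinarith [mul_self_nonneg z.im]

/-- The hypothesis says that the number squared in `sqFun_conjBy` has positive real part, so the
principal root returns that number and not its negative. -/
lemma liftMat_conjBy {R : SO3} (h : 0 < R.1 0 0 + R.1 1 1) :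
    sqFun (conjBy R A₀) ∈ Complex.slitPlane ∧ liftMat (conjBy R A₀) = R.1 := by
  rw [← frameVec_sub_re] at h
  refine ⟨by rw [sqFun_conjBy]; exact sq_mem_slitPlane h.ne', ?_⟩
  have hne : frameVec R 0 - Complex.I * frameVec R 1 ≠ 0 := by
    intro h0
    rw [h0] at h
    simp at h
  have hl : liftVec (conjBy R A₀) = frameVec R := by
    ext k
    rw [liftVec, sqFun_conjBy, Complex.sq_cpow_two_inv h, conjBy_A₀]
    simp only [Matrix.vecMulVec_apply]
    rw [div_eq_iff hne]
    ring
  rw [liftMat, hl]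
  simp only [frameVec_re, frameVec_im]
  obtain ⟨-, -, r0, -, -, r1, -, -, r2⟩ := SO3_cofactor R
  ext i j
  fin_cases j
  · rfl
  · rfl
  · fin_cases i
    · simp [cross_apply]; linarith
    · simp [cross_apply]; linarith
    · simp [cross_apply]; linarith

/-- The two rotations over `B` have opposite frame vectors. A square in the slit plane has a root of
nonzero real part, so exactly one of them meets the sign condition. -/
lemma exists_rot_of_mem_slitPlane {B : GL3C} (hB : B ∈ Omega6.orbit)
    (h : sqFun B ∈ Complex.slitPlane) : ∃ R : SO3, 0 < R.1 0 0 + R.1 1 1 ∧ B = conjBy R A₀ := by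
  obtain ⟨R, rfl⟩ := (mem_orbit_iff B).1 hB
  rw [sqFun_conjBy] at h
  have h1 := re_ne_zero_of_sq_mem_slitPlane h
  rcases lt_or_gt_of_ne h1 with h2 | h2
  · refine ⟨R * Jminus, ?_, ((conjBy_A₀_eq_iff _ _).2 (Or.inr rfl)).symm⟩
    rw [← frameVec_sub_re, frameVec_mul_Jminus]
    simp only [Pi.neg_apply]
    simp at h2 ⊢
    linarith
  · exact ⟨R, by rwa [← frameVec_sub_re], rfl⟩

lemma contDiff_sqFun : ContDiff ℝ ∞ sqFun := by
  rw [contDiff_iff_contDiffAt]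
  intro B
  have e := fun i j => (contDiffAt_id (𝕜 := ℝ) (n := ∞) (x := B)).entry i j
  exact (((e 0 0).sub (contDiffAt_const.mul (e 0 1))).sub (contDiffAt_const.mul (e 1 0))).sub
    (e 1 1)

lemma contDiffAt_liftVec {B : GL3C} (h : sqFun B ∈ Complex.slitPlane) (k : Fin 3) :
    ContDiffAt ℝ ∞ (fun B => liftVec B k) B := by
  have e := fun i j => (contDiffAt_id (𝕜 := ℝ) (n := ∞) (x := B)).entry i j
  have hs : ContDiffAt ℝ ∞ (fun z : ℂ => z ^ (2⁻¹ : ℂ)) (sqFun B) := by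
    have : AnalyticAt ℂ (fun z : ℂ => z ^ (2⁻¹ : ℂ)) (sqFun B) :=
      analyticAt_id.cpow analyticAt_const h
    exact (this.contDiffAt (n := ∞)).restrict_scalars ℝ
  have hc : ContDiffAt ℝ ∞ (fun B => sqFun B ^ (2⁻¹ : ℂ)) B :=
    hs.comp B contDiff_sqFun.contDiffAt
  refine (((e k 0).sub (contDiffAt_const.mul (e k 1))).mul (hc.inv ?_)).congr_of_eventuallyEq
    (Filter.Eventually.of_forall fun B => div_eq_mul_inv _ _)
  simp [Complex.cpow_eq_zero_iff, Complex.slitPlane_ne_zero h]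

lemma contDiffAt_liftMat {B : GL3C} (h : sqFun B ∈ Complex.slitPlane) :
    ContDiffAt ℝ ∞ liftMat B := by
  have hr := fun k => (contDiffAt_liftVec h k).re
  have hi := fun k => (contDiffAt_liftVec h k).im
  refine contDiffAt_matrix fun i j => ?_
  fin_cases j
  · exact hr i
  · exact hi i
  · fin_cases i
    · exact ((hr 1).mul (hi 2)).sub ((hr 2).mul (hi 1))
    · exact ((hr 2).mul (hi 0)).sub ((hr 0).mul (hi 2))
    · exact ((hr 0).mul (hi 1)).sub ((hr 1).mul (hi 0))

/-- The domain of the local section around `conjBy Q A₀`. -/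
def sectionDomain (Q : SO3) : Set GL3C := {B | sqFun (conjBy Q⁻¹ B) ∈ Complex.slitPlane}

/-- The local section of `R ↦ R A₀ R⁻¹` around `conjBy Q A₀`. -/
def sectionAt (Q : SO3) (B : GL3C) : Matrix (Fin 3) (Fin 3) ℝ := Q.1 * liftMat (conjBy Q⁻¹ B)

lemma continuous_conjBy (R : SO3) : Continuous (conjBy R) :=
  (contDiff_iff_contDiffAt.2 fun _ => contDiffAt_id.conjBy R : ContDiff ℝ ∞ (conjBy R)).continuous

lemma isOpen_sectionDomain (Q : SO3) : IsOpen (sectionDomain Q) :=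
  Complex.isOpen_slitPlane.preimage (contDiff_sqFun.continuous.comp (continuous_conjBy Q⁻¹))

lemma mem_sectionDomain (Q : SO3) : conjBy Q A₀ ∈ sectionDomain Q := by
  have h : sqFun (conjBy 1 A₀) ∈ Complex.slitPlane := (liftMat_conjBy (by simp)).1
  rw [sectionDomain, Set.mem_ofPred_eq, conjBy_inv_conjBy]
  rwa [conjBy_one] at h

lemma contDiffAt_sectionAt {Q : SO3} {B : GL3C} (hB : B ∈ sectionDomain Q) :
    ContDiffAt ℝ ∞ (sectionAt Q) B :=
  contDiffAt_const.matrix_mul ((contDiffAt_liftMat hB).comp B (contDiffAt_id.conjBy Q⁻¹))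

lemma conjBy_mem_orbit (R : SO3) {A : GL3C} (hA : A ∈ Omega6.orbit) :
    conjBy R A ∈ Omega6.orbit := by
  obtain ⟨Q, rfl⟩ := (mem_orbit_iff A).1 hA
  rw [← conjBy_mul]
  exact conjBy_A₀_mem_orbit _

lemma sectionAt_spec {Q : SO3} {B : GL3C} (hB : B ∈ Omega6.orbit) (hU : B ∈ sectionDomain Q) :
    ∃ R : SO3, sectionAt Q B = R.1 ∧ B = conjBy R A₀ := by
  obtain ⟨R, hR, h⟩ := exists_rot_of_mem_slitPlane (conjBy_mem_orbit Q⁻¹ hB) hU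
  refine ⟨Q * R, ?_, ?_⟩
  · rw [sectionAt, h, (liftMat_conjBy hR).2]; rfl
  · rw [conjBy_mul, ← h, conjBy_conjBy_inv]

lemma isDiffeo_quotientEquiv : IsDiffeoFromQuotient Omega6.orbit quotientEquiv where
  smooth := by
    refine ⟨fun M => M.map Complex.ofReal * A₀ * (Mᵀ).map Complex.ofReal, ?_, fun R => rfl⟩
    intro R _
    refine ⟨Set.univ, _, isOpen_univ, trivial, ContDiff.contDiffOn ?_, fun _ _ => rfl⟩
    rw [contDiff_iff_contDiffAt]
    intro M
    have e := fun i j => (contDiffAt_id (𝕜 := ℝ) (n := ∞) (x := M)).entry i j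
    exact ((contDiffAt_matrix fun i j => (e i j).ofReal).matrix_mul contDiffAt_const).matrix_mul
      (contDiffAt_matrix fun i j => (e j i).ofReal)
  smooth_inv := by
    rintro ⟨A, hA⟩
    obtain ⟨Q, rfl⟩ := (mem_orbit_iff A).1 hA
    refine ⟨sectionDomain Q, sectionAt Q, isOpen_sectionDomain Q, mem_sectionDomain Q,
      fun B hB => (contDiffAt_sectionAt hB).contDiffWithinAt, ?_⟩
    rintro ⟨B, hB⟩ hU
    obtain ⟨R, hR, h⟩ := sectionAt_spec hB hU
    refine ⟨R, hR, ?_⟩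
    rw [Equiv.symm_apply_eq]
    exact Subtype.ext h

/-! ### Charts of the orbit -/

/-- The domain of the Cayley charts of the orbit. -/
def chartSource : Set (Fin 3 → ℝ) := {v | 0 < (cay v).1 0 0 + (cay v).1 1 1}

/-- The range of the Cayley chart around `A₀`. -/
def chartTarget : Set GL3C :=
  {B | sqFun B ∈ Complex.slitPlane} ∩ (fun B => 1 + (liftMat B).trace) ⁻¹' {0}ᶜ

lemma contDiffAt_trace {E : Type*} [NormedAddCommGroup E] [NormedSpace ℝ E]
    {f : E → Matrix (Fin 3) (Fin 3) ℝ} {x : E} (h : ContDiffAt ℝ ∞ f x) :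
    ContDiffAt ℝ ∞ (fun y => (f y).trace) x := by
  simp only [Matrix.trace, Matrix.diag_apply, Fin.sum_univ_three]
  exact ((h.entry 0 0).add (h.entry 1 1)).add (h.entry 2 2)

lemma isOpen_chartTarget : IsOpen chartTarget := by
  refine ContinuousOn.isOpen_inter_preimage (fun B hB => ?_)
    (Complex.isOpen_slitPlane.preimage contDiff_sqFun.continuous) isOpen_compl_singleton
  exact (contDiffAt_const.add
    (contDiffAt_trace (contDiffAt_liftMat hB))).continuousAt.continuousWithinAt

lemma isOpen_chartSource : IsOpen chartSource :=
  isOpen_lt continuous_const (((contDiff_iff_contDiffAt.2 fun v =>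
    ((contDiffAt_cay v).entry 0 0).add ((contDiffAt_cay v).entry 1 1)) :
      ContDiff ℝ ∞ _).continuous)

lemma neg_one_le_SO3_entry (R : SO3) : -1 ≤ R.1 2 2 := by
  have := SO3_rows R 2 2
  simp at this
  nlinarith [mul_self_nonneg (R.1 2 0), mul_self_nonneg (R.1 2 1), mul_self_nonneg (R.1 2 2 - 1)]

/-- Rotations by the angle π, which the Cayley transform misses, are thus excluded wherever the
square-root section is used. -/
lemma one_add_trace_pos {R : SO3} (h : 0 < R.1 0 0 + R.1 1 1) : 0 < 1 + R.1.trace := by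
  have := neg_one_le_SO3_entry R
  simp only [Matrix.trace, Matrix.diag_apply, Fin.sum_univ_three]
  linarith

lemma contDiffAt_cayInv {M : Matrix (Fin 3) (Fin 3) ℝ} (h : 1 + M.trace ≠ 0) :
    ContDiffAt ℝ ∞ cayInv M := by
  have e := fun i j => (contDiffAt_id (𝕜 := ℝ) (n := ∞) (x := M)).entry i j
  have ht : ContDiffAt ℝ ∞ (fun M : Matrix (Fin 3) (Fin 3) ℝ => 1 + M.trace) M :=
    contDiffAt_const.add (contDiffAt_trace contDiffAt_id)
  refine contDiffAt_pi.2 fun i => ?_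
  fin_cases i
  · exact ((e 2 1).sub (e 1 2)).div ht h
  · exact ((e 0 2).sub (e 2 0)).div ht h
  · exact ((e 1 0).sub (e 0 1)).div ht h

lemma isLocalParam_orbit (Q : SO3) :
    IsLocalParam Omega6.orbit 3 (fun v => conjBy Q (conjBy (cay v) A₀)) chartSource
      (fun B => cayInv (liftMat (conjBy Q⁻¹ B))) (conjBy Q⁻¹ ⁻¹' chartTarget) where
  isOpen_source := isOpen_chartSource
  isOpen_target := isOpen_chartTarget.preimage (continuous_conjBy _)
  smooth := fun v _ => by
    refine ContDiffAt.contDiffWithinAt (ContDiffAt.conjBy Q ?_)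
    have e := fun i j => (contDiffAt_cay v).entry i j
    exact ((contDiffAt_matrix fun i j => (e i j).ofReal).matrix_mul contDiffAt_const).matrix_mul
      (contDiffAt_matrix fun i j => (e j i).ofReal)
  smooth_inv := fun B hB => by
    refine ContDiffAt.contDiffWithinAt ?_
    have h2 : 1 + (liftMat (conjBy Q⁻¹ B)).trace ≠ 0 := hB.2
    exact ContDiffAt.comp B (contDiffAt_cayInv h2)
      ((contDiffAt_liftMat hB.1).comp B (contDiffAt_id.conjBy Q⁻¹))
  mapsTo := fun v hv => by
    refine ⟨conjBy_mem_orbit _ (conjBy_A₀_mem_orbit _), ?_⟩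
    have h := liftMat_conjBy hv
    simp only [Set.mem_preimage, conjBy_inv_conjBy]
    refine ⟨h.1, ?_⟩
    simp only [Set.mem_preimage, h.2]
    exact (one_add_trace_pos hv).ne'
  mapsTo_inv := fun B hB => by
    obtain ⟨R, hR, h⟩ := exists_rot_of_mem_slitPlane (conjBy_mem_orbit Q⁻¹ hB.1) hB.2.1
    simp only [h, (liftMat_conjBy hR).2]
    rw [chartSource, Set.mem_ofPred_eq, cay_cayInv R (one_add_trace_pos hR).ne']
    exact hR
  left_inv := fun v hv => by
    simp only [conjBy_inv_conjBy, (liftMat_conjBy hv).2, cayInv_cay]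
  right_inv := fun B hB => by
    obtain ⟨R, hR, h⟩ := exists_rot_of_mem_slitPlane (conjBy_mem_orbit Q⁻¹ hB.1) hB.2.1
    simp only [h, (liftMat_conjBy hR).2]
    rw [cay_cayInv R (one_add_trace_pos hR).ne', ← h, conjBy_conjBy_inv]

lemma mem_chartTarget (Q : SO3) : conjBy Q A₀ ∈ conjBy Q⁻¹ ⁻¹' chartTarget := by
  have h1 : 0 < (1 : SO3).1 0 0 + (1 : SO3).1 1 1 := by simp
  have h := liftMat_conjBy h1
  rw [conjBy_one] at h
  simp only [Set.mem_preimage, conjBy_inv_conjBy]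
  refine ⟨h.1, ?_⟩
  simp only [Set.mem_preimage, h.2]
  exact (one_add_trace_pos h1).ne'

/-- Coordinates on `ℝ³ × ℝ³`. -/
def splitEquiv : ((Fin 3 → ℝ) × (Fin 3 → ℝ)) ≃L[ℝ] (Fin (2 * 3) → ℝ) :=
  ContinuousLinearEquiv.ofFinrankEq (by simp)

lemma IsLocalParam.univ_prod {S : Set GL3C} {φ : (Fin 3 → ℝ) → GL3C} {W : Set (Fin 3 → ℝ)}
    {ψ : GL3C → Fin 3 → ℝ} {U : Set GL3C} (h : IsLocalParam S 3 φ W ψ U) :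
    IsLocalParam ((Set.univ : Set (Fin 3 → ℝ)) ×ˢ S) (2 * 3)
      (fun u => ((splitEquiv.symm u).2, φ (splitEquiv.symm u).1))
      ((fun u => (splitEquiv.symm u).1) ⁻¹' W)
      (fun p => splitEquiv (ψ p.2, p.1)) (Prod.snd ⁻¹' U) where
  isOpen_source := h.isOpen_source.preimage (continuous_fst.comp splitEquiv.symm.continuous)
  isOpen_target := h.isOpen_target.preimage continuous_snd
  smooth := by
    refine ContDiffOn.prodMk ?_ ?_
    · exact (contDiff_snd.comp splitEquiv.symm.contDiff).contDiffOn
    · exact h.smooth.comp (contDiff_fst.comp splitEquiv.symm.contDiff).contDiffOn fun u hu => hu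
  smooth_inv := by
    refine splitEquiv.contDiff.comp_contDiffOn (ContDiffOn.prodMk ?_ contDiff_fst.contDiffOn)
    exact h.smooth_inv.comp contDiff_snd.contDiffOn fun p hp => hp
  mapsTo := fun u hu => ⟨⟨trivial, (h.mapsTo hu).1⟩, (h.mapsTo hu).2⟩
  mapsTo_inv := fun p hp => by
    simpa using h.mapsTo_inv ⟨hp.1.2, hp.2⟩
  left_inv := fun u hu => by
    have := h.left_inv hu
    simp only [this]
    simp
  right_inv := fun p hp => by
    have := h.right_inv ⟨hp.1.2, hp.2⟩
    simp [this]

end Omega6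

end

noncomputable section

namespace Omega6

/-! ### The Hamiltonian vector fields -/

lemma ip_comm (A B : GL3C) : ip A B = ip B A := by
  rw [← gip_one, gip_comm, gip_one]

lemma ip_add_right (A B C : GL3C) : ip C (A + B) = ip C A + ip C B := by
  simp [ip, Matrix.mul_add]

lemma ip_sub_left (A B C : GL3C) : ip (A - B) C = ip A C - ip B C := by
  simp [ip, Matrix.sub_mul]

lemma ip_neg_right (A C : GL3C) : ip C (-A) = -ip C A := by
  simp [ip]

lemma ip_smul_right (c : ℝ) (A C : GL3C) : ip C (c • A) = c * ip C A := by
  simp [ip]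

lemma eq_of_ip_eq {A B : GL3C} (h : ∀ u, ip A u = ip B u) : A = B := by
  rw [← sub_eq_zero]
  apply eq_zero_of_gip_self (γ₁ := 1) (γ₂ := 0) (γ₃ := 0) one_pos (by norm_num)
  rw [gip_one, ip_sub_left, h, sub_self]

/-- The adjoint of `w ↦ [A, hat w]`. -/
def adjHat (A v : GL3C) : Fin 3 → ℝ := fun a => ip v ⁅A, hat (Pi.single a 1)⁆

lemma adjHat_dot (A v : GL3C) (w : Fin 3 → ℝ) : adjHat A v ⬝ᵥ w = ip v ⁅A, hat w⁆ := by
  rw [bracket_hat_eq_sum A w]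
  simp only [ip_add_right, ip_smul_right, dotProduct, Fin.sum_univ_three, adjHat]
  ring

/-- The adjoint `T*` of an injective map `T` is onto, with right inverse `T (T* T)⁻¹`; here `T* T`
is `inertia 1 0 0 A`. -/
lemma adjHat_surjective {A : GL3C} (hA : A ∈ Omega6.orbit) (μ : Fin 3 → ℝ) :
    ∃ v, adjHat A v = μ := by
  have hd : IsUnit (inertia 1 0 0 A).det :=
    (inertia_det_ne_zero (γ₁ := 1) (γ₂ := 0) (γ₃ := 0) one_pos (by norm_num) hA).isUnit
  refine ⟨⁅A, hat ((inertia 1 0 0 A)⁻¹ *ᵥ μ)⁆, ?_⟩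
  ext a
  rw [adjHat, ip_comm, ← gip_one, ← dot_inertia, Matrix.mulVec_mulVec, Matrix.mul_nonsing_inv _ hd,
    Matrix.one_mulVec, single_one_dotProduct]

lemma bracket_skew (A B : GL3C) : ⁅A, B⁆ = -⁅B, A⁆ := by
  simp [Ring.lie_def]

/-- The Hamiltonian vector at `p` of a function with functional derivative `Y`. -/
def ham (p Y : SemiAlg) : SemiAlg :=
  (crossProduct Y.1 p.1 + adjHat p.2 Y.2, ⁅hat Y.1, p.2⁆)

lemma poissonTensor_eq (p X Y : SemiAlg) : poissonTensor p X Y = pairing (ham p Y) X := by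
  have h := triple_product_permutation p.1 X.1 Y.1
  rw [dotProduct_comm X.1] at h
  rw [poissonTensor, pairing, ham, h, add_dotProduct, adjHat_dot, bracket_skew p.2 (hat Y.1),
    ip_neg_right, sub_neg_eq_add, ip_comm X.2]

lemma poissonTensor_swap (p X Y : SemiAlg) : poissonTensor p X Y = -poissonTensor p Y X := by
  rw [poissonTensor, poissonTensor, ← cross_anticomm, dotProduct_neg]
  ring

/-! ### The coadjoint orbit -/

lemma hat_zero : hat 0 = 0 := hatL.map_zero

lemma hat_conjTranspose (w : Fin 3 → ℝ) : (hat w)ᴴ = -hat w := by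
  ext i j
  fin_cases i <;> fin_cases j <;> simp [hat]

/-- Since `hat w` is skew-Hermitian, bracketing with it is skew for `ip`. -/
lemma ip_bracket_hat (A v : GL3C) (w : Fin 3 → ℝ) : ip A ⁅hat w, v⁆ = ip v ⁅A, hat w⁆ := by
  rw [ip_comm v]
  simp only [ip, Ring.lie_def, Matrix.conjTranspose_sub, Matrix.conjTranspose_mul,
    hat_conjTranspose, Matrix.mul_sub, Matrix.sub_mul, Matrix.trace_sub, Matrix.neg_mul,
    Matrix.mul_neg, Matrix.trace_neg, Complex.sub_re, Complex.neg_re]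
  rw [Matrix.mul_assoc (hat w), Matrix.trace_mul_comm (hat w), Matrix.mul_assoc, Matrix.mul_assoc]
  ring

lemma pairing_Ad (s : SemiGroup) (X : SemiAlg) :
    pairing (0, A₀) (Ad s X) = ip (conjBy s.right⁻¹ A₀) X.2 -
      ip s.left.toAdd ⁅A₀, hat (s.right.1 *ᵥ X.1)⁆ := by
  have h : ip A₀ (conjBy s.right X.2) = ip (conjBy s.right⁻¹ A₀) X.2 := by
    rw [← ip_conjBy s.right (conjBy s.right⁻¹ A₀), conjBy_conjBy_inv]
  rw [pairing, Ad, zero_dotProduct, zero_add, ← h, ← ip_bracket_hat, sub_eq_add_neg,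
    ip_add_right, ip_neg_right, sub_eq_add_neg]

lemma coadjointOrbit_eq :
    coadjointOrbit (0, A₀) = (Set.univ : Set (Fin 3 → ℝ)) ×ˢ Omega6.orbit := by
  have hA₀ : A₀ ∈ Omega6.orbit := (mem_orbit_iff _).2 ⟨1, (conjBy_one _).symm⟩
  ext ⟨m, A⟩
  simp only [Set.mem_prod, Set.mem_univ, true_and]
  constructor
  · rintro ⟨s, hs⟩
    have : A = conjBy s⁻¹.right⁻¹ A₀ := by
      refine eq_of_ip_eq fun u => ?_
      have := hs (0, u)
      rw [pairing_Ad, Matrix.mulVec_zero, hat_zero] at this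
      simpa [pairing, ip, Ring.lie_def] using this
    rw [this]
    exact conjBy_A₀_mem_orbit _
  · intro hA
    obtain ⟨R, rfl⟩ := (mem_orbit_iff A).1 hA
    -- The translation `v` produces the momentum; the sign cancels the minus in `pairing_Ad`, and
    -- `R⁻¹` undoes the rotation applied to `X.1`.
    obtain ⟨v, hv⟩ := adjHat_surjective hA₀ (-((R⁻¹ : SO3).1 *ᵥ m))
    refine ⟨(⟨Multiplicative.ofAdd v, R⁻¹⟩ : SemiGroup)⁻¹, fun X => ?_⟩
    rw [inv_inv, pairing_Ad, inv_inv, toAdd_ofAdd, ← adjHat_dot, hv, neg_dotProduct,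
      SO3_dot, pairing, sub_neg_eq_add, add_comm]

/-! ### Curves -/

lemma hasDerivAt_matrix {F : Type*} [NormedAddCommGroup F] [NormedSpace ℝ F]
    {f : ℝ → Matrix (Fin 3) (Fin 3) F} {f' : Matrix (Fin 3) (Fin 3) F} {t : ℝ}
    (h : ∀ i j, HasDerivAt (fun s => f s i j) (f' i j) t) : HasDerivAt f f' t :=
  hasDerivAt_pi.2 fun i => hasDerivAt_pi.2 fun j => h i j

lemma HasDerivAt.entry {F : Type*} [NormedAddCommGroup F] [NormedSpace ℝ F]
    {f : ℝ → Matrix (Fin 3) (Fin 3) F} {f' : Matrix (Fin 3) (Fin 3) F} {t : ℝ}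
    (h : HasDerivAt f f' t) (i j : Fin 3) : HasDerivAt (fun s => f s i j) (f' i j) t :=
  hasDerivAt_pi.1 (hasDerivAt_pi.1 h i) j

lemma HasDerivAt.matrix_mul {F : Type*} [NormedRing F] [NormedAlgebra ℝ F]
    {f g : ℝ → Matrix (Fin 3) (Fin 3) F} {f' g' : Matrix (Fin 3) (Fin 3) F} {t : ℝ}
    (hf : HasDerivAt f f' t) (hg : HasDerivAt g g' t) :
    HasDerivAt (fun s => f s * g s) (f' * g t + f t * g') t := by
  refine hasDerivAt_matrix fun i j => ?_
  simp only [Matrix.mul_apply, Matrix.add_apply, Fin.sum_univ_three]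
  exact ((((hf.entry i 0).mul (hg.entry 0 j)).add ((hf.entry i 1).mul (hg.entry 1 j))).add
    ((hf.entry i 2).mul (hg.entry 2 j))).congr_deriv (by abel)

lemma HasDerivAt.transpose {F : Type*} [NormedAddCommGroup F] [NormedSpace ℝ F]
    {f : ℝ → Matrix (Fin 3) (Fin 3) F} {f' : Matrix (Fin 3) (Fin 3) F} {t : ℝ}
    (h : HasDerivAt f f' t) : HasDerivAt (fun s => (f s)ᵀ) f'ᵀ t :=
  hasDerivAt_matrix fun i j => h.entry j i

lemma HasDerivAt.map_ofReal {f : ℝ → Matrix (Fin 3) (Fin 3) ℝ}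
    {f' : Matrix (Fin 3) (Fin 3) ℝ} {t : ℝ} (h : HasDerivAt f f' t) :
    HasDerivAt (fun s => (f s).map Complex.ofReal) (f'.map Complex.ofReal) t :=
  hasDerivAt_matrix fun i j => (h.entry i j).ofReal_comp

lemma hasDerivAt_quadratic (a b c : ℝ) : HasDerivAt (fun t : ℝ => a + b * t + c * t ^ 2) b 0 := by
  have h := (((hasDerivAt_id (0 : ℝ)).const_mul b).const_add a).add
    (((hasDerivAt_id (0 : ℝ)).pow 2).const_mul c)
  exact h.congr_deriv (by simp)

/-- A curve of rotations with velocity `hat η` at the identity. -/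
def rotCurve (η : Fin 3 → ℝ) (t : ℝ) : SO3 := cay ((t / 2) • η)

lemma rotCurve_zero (η : Fin 3 → ℝ) : rotCurve η 0 = 1 := by
  apply Subtype.ext
  ext i j
  rw [rotCurve, cay_apply]
  fin_cases i <;> fin_cases j <;> simp [cayDen, cayNum]

/-- To first order `cay v` is `1 + 2 hatR v`, which explains the parameter `t / 2`. The denominator
is stationary at 0, so only the linear term of the numerator contributes. -/
lemma hasDerivAt_rotCurve (η : Fin 3 → ℝ) :
    HasDerivAt (fun t => (rotCurve η t).1) (hatR η) 0 := by
  have hd : HasDerivAt (fun t : ℝ => cayDen ((t / 2) • η)) 0 0 := by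
    convert hasDerivAt_quadratic 1 0 ((η 0 ^ 2 + η 1 ^ 2 + η 2 ^ 2) / 4) using 2 with t
    simp [cayDen]; ring
  have h0 : cayDen (((0 : ℝ) / 2) • η) = 1 := by simp [cayDen]
  have hn : ∀ i j, HasDerivAt (fun t : ℝ => cayNum ((t / 2) • η) i j) (hatR η i j) 0 := by
    intro i j
    have : ∃ a c, ∀ t : ℝ, cayNum ((t / 2) • η) i j = a + hatR η i j * t + c * t ^ 2 := by
      -- The entries are quadratic in `t`: `a` is read off at `t = 0`, and `c` from the value at `t
      -- = 1`.
      refine ⟨cayNum 0 i j, (cayNum ((1 / 2 : ℝ) • η) i j) - cayNum 0 i j - hatR η i j, fun t => ?_⟩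
      fin_cases i <;> fin_cases j <;> simp [cayNum, hatR] <;> ring
    obtain ⟨a, c, h⟩ := this
    simp only [h]
    exact hasDerivAt_quadratic _ _ _
  refine hasDerivAt_matrix fun i j => ?_
  simp only [rotCurve, cay_apply]
  have := (hd.inv (by rw [h0]; exact one_ne_zero)).mul (hn i j)
  refine this.congr_deriv ?_
  rw [Pi.inv_apply, h0]
  simp

lemma hatR_transpose (w : Fin 3 → ℝ) : (hatR w)ᵀ = -hatR w := by
  ext i j
  fin_cases i <;> fin_cases j <;> simp [hatR]

lemma hasDerivAt_conjBy_rotCurve (η : Fin 3 → ℝ) (A : GL3C) :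
    HasDerivAt (fun t => conjBy (rotCurve η t) A) ⁅hat η, A⁆ 0 := by
  have h := hasDerivAt_rotCurve η
  have h1 := (h.map_ofReal.matrix_mul (hasDerivAt_const (0 : ℝ) A)).matrix_mul
    h.transpose.map_ofReal
  refine h1.congr_deriv ?_
  have e : (-hatR η).map Complex.ofReal = -hat η := by
    rw [hat_eq_map]; ext i j; simp
  simp only [rotCurve_zero, hatR_transpose, e, ← hat_eq_map]
  simp [Ring.lie_def, Matrix.map_one, sub_eq_add_neg]

lemma hasDerivAt_rotCurve_mulVec (η v : Fin 3 → ℝ) :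
    HasDerivAt (fun t => (rotCurve η t).1 *ᵥ v) (crossProduct η v) 0 := by
  have h := hasDerivAt_rotCurve η
  refine hasDerivAt_pi.2 fun i => ?_
  rw [← hatR_mulVec]
  simp only [Matrix.mulVec, dotProduct, Fin.sum_univ_three]
  exact (((h.entry i 0).mul_const _).add ((h.entry i 1).mul_const _)).add
    ((h.entry i 2).mul_const _)

lemma exists_hatR_eq {S : Matrix (Fin 3) (Fin 3) ℝ} (h : S + Sᵀ = 0) : ∃ η, S = hatR η := by
  refine ⟨![S 2 1, S 0 2, S 1 0], ?_⟩
  have e := fun i j => congrFun (congrFun h i) j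
  have e00 := e 0 0
  have e11 := e 1 1
  have e22 := e 2 2
  have e01 := e 0 1
  have e02 := e 0 2
  have e12 := e 1 2
  simp only [Matrix.add_apply, Matrix.transpose_apply, Matrix.zero_apply] at e00 e11 e22 e01 e02 e12
  ext i j
  fin_cases i <;> fin_cases j <;> simp [hatR] <;> linarith

/-- A curve in the orbit lifts through the local section to a differentiable curve of rotations,
whose velocity is `hatR η * R`. Conversely `rotCurve η` realizes every `η`, and the momentum
component is unconstrained. -/
lemma mem_tangentVectors_iff {m : Fin 3 → ℝ} {A : GL3C} (hA : A ∈ Omega6.orbit) (v : SemiAlg) :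
    v ∈ tangentVectors ((Set.univ : Set (Fin 3 → ℝ)) ×ˢ Omega6.orbit) (m, A) ↔
      ∃ η, v.2 = ⁅hat η, A⁆ := by
  constructor
  · rintro ⟨γ, h0, hγ, hS⟩
    obtain ⟨Q, hQ⟩ := (mem_orbit_iff A).1 hA
    have hB : HasDerivAt (fun t => (γ t).2) v.2 0 := hγ.snd
    have hB0 : (γ 0).2 = A := by rw [h0]
    have hU : A ∈ sectionDomain Q := hQ ▸ mem_sectionDomain Q
    have hev : ∀ᶠ t in nhds (0 : ℝ), ∃ R : SO3, sectionAt Q (γ t).2 = R.1 ∧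
        (γ t).2 = conjBy R A₀ := by
      have : ∀ᶠ t in nhds (0 : ℝ), (γ t).2 ∈ sectionDomain Q :=
        hB.continuousAt.eventually_mem ((isOpen_sectionDomain Q).mem_nhds (by rwa [hB0]))
      filter_upwards [hS, this] with t h1 h2
      exact sectionAt_spec h1.2 h2
    have hd : DifferentiableAt ℝ (sectionAt Q) (γ 0).2 := by
      rw [hB0]
      exact (contDiffAt_sectionAt hU).differentiableAt (by simp)
    have hN := HasFDerivAt.comp_hasDerivAt (f := fun t => (γ t).2) (0 : ℝ) hd.hasFDerivAt hB
    set N' := fderiv ℝ (sectionAt Q) (γ 0).2 v.2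
    change HasDerivAt (fun t => sectionAt Q (γ t).2) N' 0 at hN
    obtain ⟨R, hR, hRA⟩ := sectionAt_spec hA hU
    -- Differentiate `R Rᵀ = 1` along the lifted curve; the lift takes values in rotations for `t`
    -- near 0.
    have hortho : N' * R.1ᵀ + R.1 * N'ᵀ = 0 := by
      have h1 := hN.matrix_mul hN.transpose
      have h2 : HasDerivAt (fun _ : ℝ => (1 : Matrix (Fin 3) (Fin 3) ℝ)) 0 0 := hasDerivAt_const _ _
      have h3 := h1.unique (h2.congr_of_eventuallyEq (by
        filter_upwards [hev] with t ⟨R, h, _⟩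
        rw [h, SO3_mul_transpose]))
      simpa only [hB0, hR] using h3
    have hv : v.2 = N'.map Complex.ofReal * A₀ * (R.1ᵀ).map Complex.ofReal +
        R.1.map Complex.ofReal * A₀ * (N'ᵀ).map Complex.ofReal := by
      have h1 := (hN.map_ofReal.matrix_mul (hasDerivAt_const (0 : ℝ) A₀)).matrix_mul
        hN.transpose.map_ofReal
      have h3 := hB.unique (h1.congr_of_eventuallyEq (by
        filter_upwards [hev] with t ⟨R, h, h'⟩
        rw [h, h']; rfl))
      simpa only [hB0, hR, mul_zero, add_zero] using h3
    obtain ⟨η, hη⟩ := exists_hatR_eq (S := N' * R.1ᵀ) (by simpa using hortho)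
    have hN' : N' = hatR η * R.1 := by
      rw [← hη, Matrix.mul_assoc, SO3_transpose_mul, mul_one]
    refine ⟨η, ?_⟩
    rw [hv, hN', Matrix.transpose_mul, hatR_transpose, map_ofReal_mul, map_ofReal_mul]
    have e : (-hatR η).map Complex.ofReal = -hat η := by
      rw [hat_eq_map]; ext i j; simp
    have hA' : A = R.1.map Complex.ofReal * A₀ * (R.1ᵀ).map Complex.ofReal := hRA
    rw [e, ← hat_eq_map, Ring.lie_def, hA']
    simp only [Matrix.mul_assoc, Matrix.mul_neg, sub_eq_add_neg]
  · rintro ⟨η, hη⟩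
    refine ⟨fun t => (m + t • v.1, conjBy (rotCurve η t) A), ?_, ?_, ?_⟩
    · simp [rotCurve_zero, conjBy_one]
    · have h1 : HasDerivAt (fun t : ℝ => m + t • v.1) v.1 0 := by
        simpa using ((hasDerivAt_id (0 : ℝ)).smul_const v.1).const_add m
      have h2 := h1.prodMk (hasDerivAt_conjBy_rotCurve η A)
      rwa [← hη] at h2
    · exact Filter.Eventually.of_forall fun t => ⟨trivial, conjBy_mem_orbit _ hA⟩

lemma symplectic_iff {p : SemiAlg} (hp : p ∈ (Set.univ : Set (Fin 3 → ℝ)) ×ˢ Omega6.orbit)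
    (X : SemiAlg) : (∀ Y, poissonTensor p X Y = 0) ↔
    ∀ v ∈ tangentVectors ((Set.univ : Set (Fin 3 → ℝ)) ×ˢ Omega6.orbit) p, pairing v X = 0 := by
  obtain ⟨m, A⟩ := p
  have hA : A ∈ Omega6.orbit := hp.2
  simp only [poissonTensor_eq]
  constructor
  · intro h v hv
    obtain ⟨η, hη⟩ := (mem_tangentVectors_iff hA v).1 hv
    -- Once `η` matches the orbit component, `u` corrects the momentum component, so every tangent
    -- vector is Hamiltonian.
    obtain ⟨u, hu⟩ := adjHat_surjective hA (v.1 - crossProduct η m)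
    have hv' : v = ham (m, A) (η, u) := by
      refine Prod.ext ?_ hη
      simp [ham, hu]
    rw [hv']
    exact h _
  · intro h Y
    exact h _ ((mem_tangentVectors_iff hA _).2 ⟨Y.1, rfl⟩)

/-! ### Brackets as derivatives -/

lemma pairing_funcDeriv (f : SemiAlg → ℝ) (p v : SemiAlg) :
    pairing v (funcDeriv f p) = fderiv ℝ f p v := by
  obtain ⟨m, B⟩ := v
  set L := fderiv ℝ f p with hL
  have h1 : (m, B) = (m, (0 : GL3C)) + ((0 : Fin 3 → ℝ), B) := by simp
  have h2 : (m, (0 : GL3C)) = ∑ i, m i • ((Pi.single i 1 : Fin 3 → ℝ), (0 : GL3C)) := by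
    refine Prod.ext ?_ ?_
    · ext i
      fin_cases i <;> simp [Fin.sum_univ_three]
    · simp [Fin.sum_univ_three]
  have h3 : ((0 : Fin 3 → ℝ), B) = ∑ i, ∑ j,
      ((B i j).re • ((0 : Fin 3 → ℝ), (Matrix.single i j 1 : GL3C)) +
        (B i j).im • ((0 : Fin 3 → ℝ), (Matrix.single i j Complex.I : GL3C))) := by
    refine Prod.ext ?_ ?_
    · simp [Fin.sum_univ_three]
    · ext i j
      fin_cases i <;> fin_cases j <;> simp [Fin.sum_univ_three, Matrix.single]
  rw [h1, map_add, ← h1]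
  rw [pairing]
  congr 1
  · rw [h2]
    simp only [map_sum, map_smul]
    simp only [funcDeriv, dotProduct, smul_eq_mul, hL]
  · rw [h3]
    simp only [map_sum, map_add, map_smul]
    simp only [ip, funcDeriv, Matrix.trace, Matrix.diag_apply, Matrix.mul_apply,
      Matrix.conjTranspose_apply, Matrix.of_apply, Fin.sum_univ_three]
    simp [← hL]
    ring

lemma bracket_eq (f g : SemiAlg → ℝ) (p : SemiAlg) :
    bracket f g p = fderiv ℝ f p (ham p (funcDeriv g p)) := by
  rw [bracket, poissonTensor_eq, pairing_funcDeriv]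

lemma bracket_swap (f g : SemiAlg → ℝ) (p : SemiAlg) : bracket f g p = -bracket g f p :=
  poissonTensor_swap _ _ _

/-- Tangential derivatives can thus be computed along curves inside the orbit, where closed formulas
such as `jm_eq` hold. -/
lemma fderiv_eq_of_curve {E : Type*} [NormedAddCommGroup E] [NormedSpace ℝ E] {f : E → ℝ} {p v : E}
    {d : ℝ} {γ : ℝ → E} (hf : DifferentiableAt ℝ f p) (h0 : γ 0 = p) (hγ : HasDerivAt γ v 0)
    (hd : HasDerivAt (fun t => f (γ t)) d 0) : fderiv ℝ f p v = d := by
  subst h0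
  exact (hf.hasFDerivAt.comp_hasDerivAt (0 : ℝ) hγ).unique hd

end Omega6

end

noncomputable section

namespace Omega6

/-! ### Smoothness of the integrals -/

section Smooth

variable {E : Type*} [NormedAddCommGroup E] [NormedSpace ℝ E] (γ₁ γ₂ γ₃ : ℝ)

lemma ContDiffAt.bracket {f g : E → GL3C} {x : E} (hf : ContDiffAt ℝ ∞ f x)
    (hg : ContDiffAt ℝ ∞ g x) : ContDiffAt ℝ ∞ (fun y => ⁅f y, g y⁆) x := by
  have h1 := hf.matrix_mul hg
  have h2 := hg.matrix_mul hf
  exact contDiffAt_matrix fun i j => (h1.entry i j).sub (h2.entry i j)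

lemma ContDiffAt.trace_conjTranspose_mul_re {f g : E → GL3C} {x : E} (hf : ContDiffAt ℝ ∞ f x)
    (hg : ContDiffAt ℝ ∞ g x) (G : GL3C) :
    ContDiffAt ℝ ∞ (fun y => (G * (f y)ᴴ * g y).trace.re) x := by
  have h1 : ContDiffAt ℝ ∞ (fun y => (f y)ᴴ) x :=
    contDiffAt_matrix fun i j => (hf.entry j i).conj
  have h2 := (contDiffAt_const (c := G)).matrix_mul h1 |>.matrix_mul hg
  simp only [Matrix.trace, Matrix.diag_apply, Fin.sum_univ_three]
  exact (((h2.entry 0 0).add (h2.entry 1 1)).add (h2.entry 2 2)).re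

lemma ContDiffAt.inertia {f : E → GL3C} {x : E} (hf : ContDiffAt ℝ ∞ f x) :
    ContDiffAt ℝ ∞ (fun y => inertia γ₁ γ₂ γ₃ (f y)) x :=
  contDiffAt_matrix fun _ _ =>
    (hf.bracket contDiffAt_const).trace_conjTranspose_mul_re (hf.bracket contDiffAt_const) _

lemma ContDiffAt.matrix_inv {f : E → Matrix (Fin 3) (Fin 3) ℝ} {x : E} (hf : ContDiffAt ℝ ∞ f x)
    (h : (f x).det ≠ 0) : ContDiffAt ℝ ∞ (fun y => (f y)⁻¹) x := by
  have e := fun i j => hf.entry i j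
  have hd : ContDiffAt ℝ ∞ (fun y => (f y).det) x := by
    simp only [Matrix.det_fin_three]
    fun_prop
  refine contDiffAt_matrix fun i j => ?_
  simp only [Matrix.inv_def, Ring.inverse_eq_inv', Matrix.smul_apply, Matrix.adjugate_fin_three]
  refine (hd.inv h).mul ?_
  fin_cases i <;> fin_cases j <;> simp <;> fun_prop

lemma ContDiffAt.matrix_mulVec {f : E → Matrix (Fin 3) (Fin 3) ℝ} {g : E → Fin 3 → ℝ} {x : E}
    (hf : ContDiffAt ℝ ∞ f x) (hg : ContDiffAt ℝ ∞ g x) :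
    ContDiffAt ℝ ∞ (fun y => f y *ᵥ g y) x := by
  refine contDiffAt_pi.2 fun i => ?_
  have e := fun j => (hf.entry i j).mul (contDiffAt_pi.1 hg j)
  simp only [Matrix.mulVec, dotProduct, Fin.sum_univ_three]
  exact ((e 0).add (e 1)).add (e 2)

lemma ContDiffAt.hat {g : E → Fin 3 → ℝ} {x : E} (hg : ContDiffAt ℝ ∞ g x) :
    ContDiffAt ℝ ∞ (fun y => hat (g y)) x :=
  (LinearMap.toContinuousLinearMap hatL).contDiff.contDiffAt.comp x hg

variable {γ₁ γ₂ γ₃}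

lemma contDiffAt_velocity {p : SemiAlg} (h : (inertia γ₁ γ₂ γ₃ p.2).det ≠ 0) :
    ContDiffAt ℝ ∞ (velocity γ₁ γ₂ γ₃) p := by
  have hm := ((contDiffAt_snd.inertia γ₁ γ₂ γ₃).matrix_inv h).matrix_mulVec contDiffAt_fst
  exact contDiffAt_pi.2 fun i => contDiffAt_const.mul (contDiffAt_pi.1 hm i)

lemma contDiffAt_hamiltonian {p : SemiAlg} (h : (inertia γ₁ γ₂ γ₃ p.2).det ≠ 0) :
    ContDiffAt ℝ ∞ (hamiltonian γ₁ γ₂ γ₃) p := by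
  have hv := contDiffAt_velocity h
  have hb := hv.hat.bracket (contDiffAt_snd (𝕜 := ℝ) (n := ∞) (p := p))
  refine ContDiffAt.sub ?_ (hb.trace_conjTranspose_mul_re hb _)
  have e := fun i => (contDiffAt_pi.1 (contDiffAt_fst (𝕜 := ℝ) (n := ∞) (p := p)) i).mul
    (contDiffAt_pi.1 hv i)
  simp only [dotProduct, Fin.sum_univ_three]
  exact ((e 0).add (e 1)).add (e 2)

lemma contDiffAt_jm {p : SemiAlg} (h : (inertia γ₁ γ₂ γ₃ p.2).det ≠ 0) :
    ContDiffAt ℝ ∞ (jm γ₁ γ₂ γ₃) p := by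
  have hv := contDiffAt_velocity h
  have hA := contDiffAt_snd (𝕜 := ℝ) (n := ∞) (p := p)
  have hb := (hv.hat.bracket hA).matrix_mul (contDiffAt_const (c := Gam γ₁ γ₂ γ₃))
  have hI : ContDiffAt ℝ ∞ (fun p : SemiAlg => Complex.I • p.2) p :=
    contDiffAt_matrix fun i j => contDiffAt_const.mul (hA.entry i j)
  have := hb.trace_conjTranspose_mul_re hI 1
  simp only [one_mul] at this
  exact contDiffAt_const.mul this

lemma contDiffAt_J₃ (p : SemiAlg) : ContDiffAt ℝ ∞ J₃ p :=
  contDiffAt_pi.1 contDiffAt_fst 2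

end Smooth

/-! ### The integrals on the coadjoint orbit -/

section Formulas

variable {γ₁ γ₂ γ₃ : ℝ}

lemma inertia_mulVec_dot (A : GL3C) (v w : Fin 3 → ℝ) :
    (inertia γ₁ γ₂ γ₃ A *ᵥ v) ⬝ᵥ w = v ⬝ᵥ (inertia γ₁ γ₂ γ₃ A *ᵥ w) := by
  rw [Matrix.dotProduct_mulVec, ← Matrix.mulVec_transpose, inertia_transpose]

lemma lagrangian_eq (w : Fin 3 → ℝ) (A : GL3C) :
    lagrangian γ₁ γ₂ γ₃ w A = w ⬝ᵥ (inertia γ₁ γ₂ γ₃ A *ᵥ w) := by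
  rw [dot_inertia, lagrangian, bracket_skew]
  simp [gip]

lemma inertia_mulVec_velocity {p : SemiAlg} (h : (inertia γ₁ γ₂ γ₃ p.2).det ≠ 0) :
    inertia γ₁ γ₂ γ₃ p.2 *ᵥ velocity γ₁ γ₂ γ₃ p = (1 / 2 : ℝ) • p.1 := by
  rw [velocity, Matrix.mulVec_smul, Matrix.mulVec_mulVec, Matrix.mul_nonsing_inv _ h.isUnit,
    Matrix.one_mulVec]

lemma hamiltonian_eq {m : Fin 3 → ℝ} {A : GL3C} (h : (inertia γ₁ γ₂ γ₃ A).det ≠ 0) :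
    hamiltonian γ₁ γ₂ γ₃ (m, A) = (1 / 4 : ℝ) * (m ⬝ᵥ ((inertia γ₁ γ₂ γ₃ A)⁻¹ *ᵥ m)) := by
  have h1 := inertia_mulVec_velocity (p := (m, A)) h
  rw [hamiltonian, lagrangian_eq, h1, velocity]
  simp only [dotProduct_smul, smul_dotProduct, smul_eq_mul]
  rw [dotProduct_comm ((inertia γ₁ γ₂ γ₃ A)⁻¹ *ᵥ m)]
  ring

/-- The phase turns twice as fast as the frame turns about its axis `R e₃`, whence the factor 1/2:
the infinitesimal circle action is an infinitesimal rotation. -/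
lemma bracket_conjBy_hat_axis (R : SO3) :
    ⁅conjBy R A₀, hat ((1 / 2 : ℝ) • (R.1 *ᵥ Pi.single 2 1))⁆ = Complex.I • conjBy R A₀ := by
  have h : ⁅A₀, hat ((1 / 2 : ℝ) • Pi.single 2 1)⁆ = Complex.I • A₀ := by
    ext i j
    simp only [Ring.lie_def, Matrix.sub_apply, Matrix.mul_apply, Fin.sum_univ_three, A₀, hat,
      Matrix.map_apply]
    fin_cases i <;> fin_cases j <;> simp <;> ring
  rw [← Matrix.mulVec_smul, hat_rot, ← conjBy_bracket, h, conjBy_smul]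

lemma ip_mul_Gam (D B : GL3C) : ip (D * Gam γ₁ γ₂ γ₃) B = gip γ₁ γ₂ γ₃ D B := by
  rw [ip, Matrix.conjTranspose_mul, Gam_conjTranspose, gip]

/-- Writing `iA` as a bracket turns `jm` into `-w · J z` with `z = R e₃`, and `J w = m / 2` removes
the inertia matrix. -/
lemma jm_eq {m : Fin 3 → ℝ} {R : SO3} (h : (inertia γ₁ γ₂ γ₃ (conjBy R A₀)).det ≠ 0) :
    jm γ₁ γ₂ γ₃ (m, conjBy R A₀) = -(1 / 2 : ℝ) * (m ⬝ᵥ (R.1 *ᵥ Pi.single 2 1)) := by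
  have h1 := inertia_mulVec_velocity (p := (m, conjBy R A₀)) h
  rw [jm, ip_mul_Gam, ← bracket_conjBy_hat_axis, bracket_skew, ← neg_one_smul ℝ, gip_smul_left,
    ← dot_inertia, ← inertia_mulVec_dot, h1]
  simp only [dotProduct_smul, smul_dotProduct, smul_eq_mul]
  ring

lemma inertia_smul {c : ℂ} (hc : star c * c = 1) (A : GL3C) :
    inertia γ₁ γ₂ γ₃ (c • A) = inertia γ₁ γ₂ γ₃ A := by
  ext a b
  have h : ∀ w, ⁅c • A, hat w⁆ = c • ⁅A, hat w⁆ := fun w => by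
    simp [Ring.lie_def, smul_sub]
  simp only [inertia, Matrix.of_apply, h, gip, Matrix.conjTranspose_smul, Matrix.mul_smul,
    Matrix.smul_mul, smul_smul]
  rw [mul_comm c, hc, one_smul]

lemma conjBy_rotCurve_Gam (t : ℝ) :
    conjBy (rotCurve (Pi.single 2 1) t) (Gam γ₁ γ₂ γ₃) = Gam γ₁ γ₂ γ₃ := by
  have h : (rotCurve (Pi.single 2 1) t).1 *
      Matrix.diagonal ![γ₁, γ₁, γ₁ + γ₂ + γ₃] =
      Matrix.diagonal ![γ₁, γ₁, γ₁ + γ₂ + γ₃] * (rotCurve (Pi.single 2 1) t).1 := by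
    ext i j
    rw [Matrix.mul_diagonal, Matrix.diagonal_mul, rotCurve, cay_apply]
    fin_cases i <;> fin_cases j <;> simp [cayNum] <;> ring
  have h2 : toC (rotCurve (Pi.single 2 1) t) * Gam γ₁ γ₂ γ₃ =
      Gam γ₁ γ₂ γ₃ * toC (rotCurve (Pi.single 2 1) t) := by
    rw [toC, Gam, ← map_ofReal_mul, h, map_ofReal_mul]
  rw [conjBy, h2, Matrix.mul_assoc, toC_mul_inv, mul_one]

end Formulas

end Omega6

end

noncomputable section

namespace Omega6

/-! ### Derivatives of the integrals -/

section Derivatives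

variable {γ₁ γ₂ γ₃ : ℝ}

lemma hasDerivAt_line (m μ : Fin 3 → ℝ) (A : GL3C) :
    HasDerivAt (fun t : ℝ => ((m + t • μ, A) : SemiAlg)) (μ, 0) 0 := by
  have h1 : HasDerivAt (fun t : ℝ => m + t • μ) μ 0 := by
    simpa using ((hasDerivAt_id (0 : ℝ)).smul_const μ).const_add m
  exact h1.prodMk (hasDerivAt_const _ _)

lemma inertia_inv_dot (A : GL3C) (v w : Fin 3 → ℝ) :
    v ⬝ᵥ ((inertia γ₁ γ₂ γ₃ A)⁻¹ *ᵥ w) = w ⬝ᵥ ((inertia γ₁ γ₂ γ₃ A)⁻¹ *ᵥ v) := by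
  rw [Matrix.dotProduct_mulVec, ← Matrix.mulVec_transpose, Matrix.transpose_nonsing_inv,
    inertia_transpose, dotProduct_comm]

lemma fderiv_hamiltonian_fst {m : Fin 3 → ℝ} {A : GL3C} (h : (inertia γ₁ γ₂ γ₃ A).det ≠ 0)
    (μ : Fin 3 → ℝ) : fderiv ℝ (hamiltonian γ₁ γ₂ γ₃) (m, A) (μ, 0) =
      (1 / 2 : ℝ) * (μ ⬝ᵥ ((inertia γ₁ γ₂ γ₃ A)⁻¹ *ᵥ m)) := by
  refine fderiv_eq_of_curve ((contDiffAt_hamiltonian (p := (m, A)) h).differentiableAt (by simp))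
    (by simp) (hasDerivAt_line m μ A) ?_
  have e : ∀ t : ℝ, hamiltonian γ₁ γ₂ γ₃ (m + t • μ, A) =
      (1 / 4 : ℝ) * (m ⬝ᵥ ((inertia γ₁ γ₂ γ₃ A)⁻¹ *ᵥ m)) +
      (1 / 2 : ℝ) * (μ ⬝ᵥ ((inertia γ₁ γ₂ γ₃ A)⁻¹ *ᵥ m)) * t +
      (1 / 4 : ℝ) * (μ ⬝ᵥ ((inertia γ₁ γ₂ γ₃ A)⁻¹ *ᵥ μ)) * t ^ 2 := fun t => by
    rw [hamiltonian_eq h]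
    simp only [Matrix.mulVec_add, Matrix.mulVec_smul, add_dotProduct, dotProduct_add,
      smul_dotProduct, dotProduct_smul, smul_eq_mul]
    rw [inertia_inv_dot A m μ]
    ring
  simp only [e]
  exact hasDerivAt_quadratic _ _ _

lemma fderiv_jm_fst {m : Fin 3 → ℝ} {R : SO3} (h : (inertia γ₁ γ₂ γ₃ (conjBy R A₀)).det ≠ 0)
    (μ : Fin 3 → ℝ) : fderiv ℝ (jm γ₁ γ₂ γ₃) (m, conjBy R A₀) (μ, 0) =
      -(1 / 2 : ℝ) * (μ ⬝ᵥ (R.1 *ᵥ Pi.single 2 1)) := by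
  refine fderiv_eq_of_curve ((contDiffAt_jm (p := (m, conjBy R A₀)) h).differentiableAt (by simp))
    (by simp) (hasDerivAt_line m μ (conjBy R A₀)) ?_
  have e : ∀ t : ℝ, jm γ₁ γ₂ γ₃ (m + t • μ, conjBy R A₀) =
      -(1 / 2 : ℝ) * (m ⬝ᵥ (R.1 *ᵥ Pi.single 2 1)) +
      (-(1 / 2 : ℝ) * (μ ⬝ᵥ (R.1 *ᵥ Pi.single 2 1))) * t + 0 * t ^ 2 := fun t => by
    rw [jm_eq h, add_dotProduct, smul_dotProduct, smul_eq_mul]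
    ring
  simp only [e]
  exact hasDerivAt_quadratic _ _ _

lemma fderiv_J₃ (p v : SemiAlg) : fderiv ℝ J₃ p v = v.1 2 := by
  have : J₃ = ((ContinuousLinearMap.proj (R := ℝ) (φ := fun _ : Fin 3 => ℝ) 2).comp
    (ContinuousLinearMap.fst ℝ (Fin 3 → ℝ) GL3C) : SemiAlg →L[ℝ] ℝ) := rfl
  rw [this, ContinuousLinearMap.fderiv]
  rfl

lemma ham_funcDeriv_J₃ (p : SemiAlg) : ham p (funcDeriv J₃ p) =
    (crossProduct (Pi.single 2 1) p.1, ⁅hat (Pi.single 2 1), p.2⁆) := by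
  have h : funcDeriv J₃ p = (Pi.single 2 1, 0) := by
    refine Prod.ext ?_ ?_
    · ext i
      rw [funcDeriv]
      fin_cases i <;> simp [fderiv_J₃]
    · ext i j
      simp [funcDeriv, fderiv_J₃, Complex.ext_iff]
  rw [h, ham]
  simp only [Prod.mk.injEq, and_true, add_eq_left]
  ext a
  simp [adjHat, ip]

/-- A function constant along simultaneous rotations about `e₃` Poisson-commutes with `J₃`. -/
lemma bracket_J₃_eq_zero {f : SemiAlg → ℝ} {m : Fin 3 → ℝ} {A : GL3C}
    (hf : DifferentiableAt ℝ f (m, A))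
    (h : ∀ t, f ((rotCurve (Pi.single 2 1) t).1 *ᵥ m, conjBy (rotCurve (Pi.single 2 1) t) A) =
      f (m, A)) : bracket f J₃ (m, A) = 0 := by
  rw [bracket_eq, ham_funcDeriv_J₃]
  refine fderiv_eq_of_curve hf (by simp [rotCurve_zero, conjBy_one])
    ((hasDerivAt_rotCurve_mulVec _ m).prodMk (hasDerivAt_conjBy_rotCurve _ A)) ?_
  simp only [h]
  exact hasDerivAt_const _ _

lemma det_inertia_conjBy (hγ₁ : 0 < γ₁) (hγ : 0 < γ₁ + γ₂ + γ₃) (R : SO3) :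
    (inertia γ₁ γ₂ γ₃ (conjBy R A₀)).det ≠ 0 :=
  inertia_det_ne_zero hγ₁ hγ (conjBy_A₀_mem_orbit R)

lemma bracket_hamiltonian_J₃ (hγ₁ : 0 < γ₁) (hγ : 0 < γ₁ + γ₂ + γ₃) (m : Fin 3 → ℝ) (R : SO3) :
    bracket (hamiltonian γ₁ γ₂ γ₃) J₃ (m, conjBy R A₀) = 0 := by
  have hd := det_inertia_conjBy hγ₁ hγ
  refine bracket_J₃_eq_zero
    ((contDiffAt_hamiltonian (p := (m, conjBy R A₀)) (hd R)).differentiableAt (by simp)) fun t => ?_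
  set Q := rotCurve (Pi.single 2 1) t with hQ
  have hinv : (inertia γ₁ γ₂ γ₃ (conjBy Q (conjBy R A₀)))⁻¹ =
      Q.1 * (inertia γ₁ γ₂ γ₃ (conjBy R A₀))⁻¹ * Q.1ᵀ := by
    apply Matrix.inv_eq_right_inv
    rw [inertia_conjBy _ _ _ Q (conjBy_rotCurve_Gam t)]
    calc _ = Q.1 * (inertia γ₁ γ₂ γ₃ (conjBy R A₀) * ((Q.1ᵀ * Q.1) *
          (inertia γ₁ γ₂ γ₃ (conjBy R A₀))⁻¹)) * Q.1ᵀ := by simp only [Matrix.mul_assoc]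
      _ = 1 := by
        rw [SO3_transpose_mul, one_mul, Matrix.mul_nonsing_inv _ (hd R).isUnit, mul_one,
          SO3_mul_transpose]
  rw [hamiltonian_eq (hd R), hamiltonian_eq (by rw [← conjBy_mul]; exact hd _), hinv,
    ← Matrix.mulVec_mulVec, ← Matrix.mulVec_mulVec, SO3_dot, ← coe_inv_SO3, SO3_inv_mulVec_mulVec]

lemma bracket_jm_J₃ (hγ₁ : 0 < γ₁) (hγ : 0 < γ₁ + γ₂ + γ₃) (m : Fin 3 → ℝ) (R : SO3) :
    bracket (jm γ₁ γ₂ γ₃) J₃ (m, conjBy R A₀) = 0 := by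
  have hd := det_inertia_conjBy hγ₁ hγ
  refine bracket_J₃_eq_zero
    ((contDiffAt_jm (p := (m, conjBy R A₀)) (hd R)).differentiableAt (by simp)) fun t => ?_
  rw [← conjBy_mul, jm_eq (hd _), jm_eq (hd _), Submonoid.coe_mul, ← Matrix.mulVec_mulVec, SO3_dot]

lemma fderiv_jm_bracket (hγ₁ : 0 < γ₁) (hγ : 0 < γ₁ + γ₂ + γ₃) (m : Fin 3 → ℝ) (R : SO3)
    (η : Fin 3 → ℝ) :
    fderiv ℝ (jm γ₁ γ₂ γ₃) (m, conjBy R A₀) (0, ⁅hat η, conjBy R A₀⁆) =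
      -(1 / 2 : ℝ) * (m ⬝ᵥ crossProduct η (R.1 *ᵥ Pi.single 2 1)) := by
  have hd := det_inertia_conjBy hγ₁ hγ
  refine fderiv_eq_of_curve
    ((contDiffAt_jm (p := (m, conjBy R A₀)) (hd R)).differentiableAt (by simp))
    (by simp [rotCurve_zero, conjBy_one])
    ((hasDerivAt_const (0 : ℝ) m).prodMk (hasDerivAt_conjBy_rotCurve η _)) ?_
  have e : ∀ t, jm γ₁ γ₂ γ₃ (m, conjBy (rotCurve η t) (conjBy R A₀)) =
      -(1 / 2 : ℝ) * (m ⬝ᵥ ((rotCurve η t).1 *ᵥ (R.1 *ᵥ Pi.single 2 1))) := fun t => by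
    rw [← conjBy_mul, jm_eq (hd _), Submonoid.coe_mul, ← Matrix.mulVec_mulVec]
  simp only [e]
  have h := fun i => (hasDerivAt_pi.1 (hasDerivAt_rotCurve_mulVec η (R.1 *ᵥ Pi.single 2 1)) i)
  refine HasDerivAt.const_mul _ ?_
  simp only [dotProduct, Fin.sum_univ_three]
  exact (((h 0).const_mul _).add ((h 1).const_mul _)).add ((h 2).const_mul _)

lemma ham_funcDeriv_jm (hγ₁ : 0 < γ₁) (hγ : 0 < γ₁ + γ₂ + γ₃) (m : Fin 3 → ℝ) (R : SO3) :
    ham (m, conjBy R A₀) (funcDeriv (jm γ₁ γ₂ γ₃) (m, conjBy R A₀)) =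
      (0, Complex.I • conjBy R A₀) := by
  have hd := det_inertia_conjBy hγ₁ hγ R
  have h1 : (funcDeriv (jm γ₁ γ₂ γ₃) (m, conjBy R A₀)).1 =
      -((1 / 2 : ℝ) • (R.1 *ᵥ Pi.single 2 1)) := by
    ext i
    rw [funcDeriv]
    simp only [fderiv_jm_fst hd, single_one_dotProduct]
    simp
  -- Only `adjHat` of the gradient in `A` enters `ham`, and it records just the derivatives in orbit
  -- directions.
  have h2 : adjHat (conjBy R A₀) (funcDeriv (jm γ₁ γ₂ γ₃) (m, conjBy R A₀)).2 =
      (1 / 2 : ℝ) • crossProduct (R.1 *ᵥ Pi.single 2 1) m := by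
    ext a
    have h := pairing_funcDeriv (jm γ₁ γ₂ γ₃) (m, conjBy R A₀)
      (0, ⁅hat (Pi.single a 1), conjBy R A₀⁆)
    rw [fderiv_jm_bracket hγ₁ hγ, pairing, zero_dotProduct, zero_add, ip_comm, bracket_skew,
      ip_neg_right] at h
    rw [adjHat, ← neg_neg (ip _ _), h, triple_product_permutation, single_one_dotProduct]
    simp
  rw [ham, h1, h2]
  refine Prod.ext ?_ ?_
  · simp
  · rw [← bracket_conjBy_hat_axis, bracket_skew, ← neg_one_smul ℝ ((1 / 2 : ℝ) • _), hat_smul]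
    simp only [Ring.lie_def, neg_one_smul, Matrix.neg_mul, Matrix.mul_neg]
    abel

lemma hasDerivAt_exp_smul (A : GL3C) :
    HasDerivAt (fun t : ℝ => Complex.exp (t * Complex.I) • A) (Complex.I • A) 0 := by
  refine hasDerivAt_matrix fun i j => ?_
  have h : HasDerivAt (fun t : ℝ => Complex.exp (t * Complex.I)) Complex.I 0 := by
    have h1 : HasDerivAt (fun t : ℝ => (t : ℂ) * Complex.I) Complex.I 0 := by
      simpa using ((hasDerivAt_id (0 : ℝ)).ofReal_comp).mul_const Complex.I
    simpa using h1.cexp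
  exact h.mul_const (A i j)

lemma bracket_hamiltonian_jm (hγ₁ : 0 < γ₁) (hγ : 0 < γ₁ + γ₂ + γ₃) (m : Fin 3 → ℝ) (R : SO3) :
    bracket (hamiltonian γ₁ γ₂ γ₃) (jm γ₁ γ₂ γ₃) (m, conjBy R A₀) = 0 := by
  have hd := det_inertia_conjBy hγ₁ hγ R
  rw [bracket_eq, ham_funcDeriv_jm hγ₁ hγ]
  refine fderiv_eq_of_curve
    ((contDiffAt_hamiltonian (p := (m, conjBy R A₀)) hd).differentiableAt (by simp))
    (by simp) ((hasDerivAt_const (0 : ℝ) m).prodMk (hasDerivAt_exp_smul _)) ?_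
  have e : ∀ t : ℝ, hamiltonian γ₁ γ₂ γ₃ (m, Complex.exp (t * Complex.I) • conjBy R A₀) =
      hamiltonian γ₁ γ₂ γ₃ (m, conjBy R A₀) := fun t => by
    have hc : star (Complex.exp (t * Complex.I)) * Complex.exp (t * Complex.I) = 1 := by
      rw [Complex.star_def, ← Complex.exp_conj, ← Complex.exp_add]
      simp
    rw [hamiltonian_eq (by rw [inertia_smul hc]; exact hd), inertia_smul hc, hamiltonian_eq hd]
  simp only [e]
  exact hasDerivAt_const _ _

lemma involution (hγ₁ : 0 < γ₁) (hγ : 0 < γ₁ + γ₂ + γ₃) (i j : Fin 3) (m : Fin 3 → ℝ) (R : SO3) :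
    bracket (![hamiltonian γ₁ γ₂ γ₃, jm γ₁ γ₂ γ₃, J₃] i)
      (![hamiltonian γ₁ γ₂ γ₃, jm γ₁ γ₂ γ₃, J₃] j) (m, conjBy R A₀) = 0 := by
  have self : ∀ f : SemiAlg → ℝ, bracket f f (m, conjBy R A₀) = 0 := fun f => by
    linarith [bracket_swap f f (m, conjBy R A₀)]
  have h1 := bracket_hamiltonian_J₃ (γ₂ := γ₂) (γ₃ := γ₃) hγ₁ hγ m R
  have h2 := bracket_jm_J₃ (γ₂ := γ₂) (γ₃ := γ₃) hγ₁ hγ m R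
  have h3 := bracket_hamiltonian_jm (γ₂ := γ₂) (γ₃ := γ₃) hγ₁ hγ m R
  fin_cases i <;> fin_cases j <;> simp [self, h1, h2, h3] <;> rw [bracket_swap] <;>
    simp [h1, h2, h3]

/-! ### Independence of the differentials -/

/-- The adjugate replaces the inverse so that the condition is continuous in the chart without a
nonvanishing assumption. Only tangent vectors `(μ, 0)` are tested. -/
lemma differentialsIndependentAt_of_ne {m : Fin 3 → ℝ} {R : SO3}
    (hd : (inertia γ₁ γ₂ γ₃ (conjBy R A₀)).det ≠ 0)
    (h : m ⬝ᵥ ((inertia γ₁ γ₂ γ₃ (conjBy R A₀)).adjugate *ᵥ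
      crossProduct (R.1 *ᵥ Pi.single 2 1) (Pi.single 2 1)) ≠ 0) :
    DifferentialsIndependentAt ((Set.univ : Set (Fin 3 → ℝ)) ×ˢ Omega6.orbit)
      ![hamiltonian γ₁ γ₂ γ₃, jm γ₁ γ₂ γ₃, J₃] (m, conjBy R A₀) := by
  intro c hc
  set z := R.1 *ᵥ Pi.single 2 1 with hz
  have key : ∀ μ : Fin 3 → ℝ, c 0 * ((1 / 2 : ℝ) *
      (m ⬝ᵥ ((inertia γ₁ γ₂ γ₃ (conjBy R A₀))⁻¹ *ᵥ μ))) +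
      c 1 * (-(1 / 2 : ℝ) * (μ ⬝ᵥ z)) + c 2 * μ 2 = 0 := fun μ => by
    have := hc (μ, 0) ((mem_tangentVectors_iff (conjBy_A₀_mem_orbit R) _).2
      ⟨0, by simp [hat_zero, Ring.lie_def]⟩)
    rw [Fin.sum_univ_three] at this
    change c 0 * fderiv ℝ (hamiltonian γ₁ γ₂ γ₃) (m, conjBy R A₀) (μ, 0) +
      c 1 * fderiv ℝ (jm γ₁ γ₂ γ₃) (m, conjBy R A₀) (μ, 0) +
      c 2 * fderiv ℝ J₃ (m, conjBy R A₀) (μ, 0) = 0 at this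
    rwa [fderiv_hamiltonian_fst hd, fderiv_jm_fst hd, fderiv_J₃, inertia_inv_dot] at this
  have hc0 : c 0 = 0 := by
    -- This `μ` is orthogonal to `z` and `e₃`, so only the `c 0` term survives.
    have h1 := key (crossProduct z (Pi.single 2 1))
    rw [dotProduct_comm _ z, dot_self_cross, Matrix.inv_def, Matrix.smul_mulVec, dotProduct_smul,
      Ring.inverse_eq_inv', smul_eq_mul] at h1
    have h2 : crossProduct z (Pi.single 2 1) 2 = 0 := by simp [cross_apply]
    rw [h2] at h1
    simp only [mul_zero, add_zero] at h1
    have h3 := mul_ne_zero (inv_ne_zero hd) h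
    by_contra h0
    exact mul_ne_zero h0 (mul_ne_zero (by norm_num) h3) h1
  have hc1 : c 1 = 0 := by
    -- The horizontal part of `z` is orthogonal to `e₃`; were it zero, `z × e₃` would vanish,
    -- contrary to `h`.
    have h1 := key ![z 0, z 1, 0]
    have h2 : ![z 0, z 1, 0] ⬝ᵥ z = z 0 ^ 2 + z 1 ^ 2 := by
      simp [dotProduct, Fin.sum_univ_three]; ring
    rw [hc0, h2] at h1
    simp at h1
    rcases h1 with h1 | h1
    · exact h1
    · exfalso
      have h3 : z 0 = 0 := by nlinarith [sq_nonneg (z 0), sq_nonneg (z 1)]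
      have h4 : z 1 = 0 := by nlinarith [sq_nonneg (z 0), sq_nonneg (z 1)]
      apply h
      have : crossProduct z (Pi.single 2 1) = 0 := by
        rw [cross_apply]
        ext i
        fin_cases i <;> simp [h3, h4]
      rw [this, Matrix.mulVec_zero, dotProduct_zero]
  have hc2 : c 2 = 0 := by
    have h1 := key (Pi.single 2 1)
    simpa [hc0, hc1] using h1
  ext i
  fin_cases i
  · exact hc0
  · exact hc1
  · exact hc2

end Derivatives

/-! ### The dependent set is null -/

open MeasureTheory

lemma volume_hyperplane {b : Fin 3 → ℝ} (hb : b ≠ 0) :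
    volume {v : Fin 3 → ℝ | v ⬝ᵥ b = 0} = 0 := by
  let s : Submodule ℝ (Fin 3 → ℝ) :=
    { carrier := {v | v ⬝ᵥ b = 0}
      add_mem' := fun {x y} hx hy => by
        show (x + y) ⬝ᵥ b = 0
        rw [add_dotProduct, show x ⬝ᵥ b = 0 from hx, show y ⬝ᵥ b = 0 from hy, add_zero]
      zero_mem' := zero_dotProduct b
      smul_mem' := fun c x hx => by
        show (c • x) ⬝ᵥ b = 0
        rw [smul_dotProduct, show x ⬝ᵥ b = 0 from hx, smul_zero] }
  refine Measure.addHaar_submodule volume s fun hs => hb ?_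
  have : b ∈ s := hs ▸ Submodule.mem_top
  exact dotProduct_self_eq_zero.1 this

lemma cay_mulVec_self (v : Fin 3 → ℝ) : (cay v).1 *ᵥ v = v := by
  have h := (cayDen_pos v).ne'
  ext i
  simp only [Matrix.mulVec, dotProduct, Fin.sum_univ_three, cay_apply]
  fin_cases i <;> simp [cayNum] <;> field_simp <;> simp [cayDen] <;> ring

/-- The rotation `cay v` fixes its axis `v`, so `cay v e₃ = q` forces `v · e₃ = v · q`, a plane
unless `q = e₃`. In that case `v` must itself be vertical, so `v 0 = 0`. -/
lemma volume_cay_eq (q : Fin 3 → ℝ) :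
    volume {v : Fin 3 → ℝ | (cay v).1 *ᵥ Pi.single 2 1 = q} = 0 := by
  by_cases hq : Pi.single 2 1 - q = 0
  · refine measure_mono_null ?_ (volume_hyperplane (b := Pi.single 0 1) (by simp))
    intro v hv
    rw [Set.mem_ofPred_eq, ← sub_eq_zero.1 hq] at hv
    have h := (cayDen_pos v).ne'
    have h0 := congrFun hv 0
    have h1 := congrFun hv 1
    simp [cay_apply, cayNum, h] at h0 h1
    rw [Set.mem_ofPred_eq, dotProduct_single_one]
    have : v 0 * (1 + v 2 ^ 2) = 0 := by linear_combination v 2 * h0 - h1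
    exact (mul_eq_zero.1 this).resolve_right (by positivity)
  · refine measure_mono_null ?_ (volume_hyperplane hq)
    intro v hv
    rw [Set.mem_ofPred_eq] at hv
    rw [Set.mem_ofPred_eq, dotProduct_sub, ← hv, sub_eq_zero]
    have := SO3_dot (cay v) v (Pi.single 2 1)
    rw [cay_mulVec_self] at this
    exact this.symm

lemma eq_or_eq_neg_of_cross_eq_zero {z : Fin 3 → ℝ} (hz : z ⬝ᵥ z = 1)
    (h : crossProduct z (Pi.single 2 1) = 0) : z = Pi.single 2 1 ∨ z = -Pi.single 2 1 := by
  have h0 := congrFun h 0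
  have h1 := congrFun h 1
  simp [cross_apply] at h0 h1
  simp [dotProduct, Fin.sum_univ_three, h0, h1] at hz
  rcases mul_self_eq_one_iff.1 hz with h2 | h2
  · left
    ext i
    fin_cases i <;> simp [h0, h1, h2]
  · right
    ext i
    fin_cases i <;> simp [h0, h1, h2]

lemma volume_axis_vertical (Q : SO3) : volume {v : Fin 3 → ℝ |
    crossProduct ((Q * cay v).1 *ᵥ Pi.single 2 1) (Pi.single 2 1) = 0} = 0 := by
  refine measure_mono_null ?_ (measure_union_null
    (volume_cay_eq ((Q⁻¹ : SO3).1 *ᵥ Pi.single 2 1))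
    (volume_cay_eq ((Q⁻¹ : SO3).1 *ᵥ (-Pi.single 2 1))))
  intro v hv
  have h1 := eq_or_eq_neg_of_cross_eq_zero (by rw [SO3_dot]; simp) hv
  rw [Submonoid.coe_mul, ← Matrix.mulVec_mulVec] at h1
  rcases h1 with h | h
  · exact Or.inl ((SO3_inv_mulVec_mulVec Q _).symm.trans (congrArg _ h))
  · exact Or.inr ((SO3_inv_mulVec_mulVec Q _).symm.trans (congrArg _ h))

/-- A linear isomorphism carries Lebesgue measure to a Haar measure, so the particular choice of
`splitEquiv` is immaterial. -/
lemma volume_splitEquiv_preimage {T : Set ((Fin 3 → ℝ) × (Fin 3 → ℝ))} (hT : MeasurableSet T)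
    (h : volume T = 0) : volume (splitEquiv.symm ⁻¹' T) = 0 := by
  have : (volume : Measure ((Fin 3 → ℝ) × (Fin 3 → ℝ))).IsAddHaarMeasure :=
    Measure.prod.instIsAddHaarMeasure _ _
  have hac : Measure.map splitEquiv.symm volume ≪
      (volume : Measure ((Fin 3 → ℝ) × (Fin 3 → ℝ))) :=
    Measure.absolutelyContinuous_isAddHaarMeasure _ _
  have := hac h
  rwa [Measure.map_apply splitEquiv.symm.continuous.measurable hT] at this

/-- In the Cayley chart around `conjBy Q A₀`, points of this set are the candidates for dependent
differentials. -/
def dependentSet (γ₁ γ₂ γ₃ : ℝ) (Q : SO3) : Set ((Fin 3 → ℝ) × (Fin 3 → ℝ)) :=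
  {q | q.2 ⬝ᵥ ((inertia γ₁ γ₂ γ₃ (conjBy (Q * cay q.1) A₀)).adjugate *ᵥ
    crossProduct ((Q * cay q.1).1 *ᵥ Pi.single 2 1) (Pi.single 2 1)) = 0}

lemma isClosed_dependentSet (γ₁ γ₂ γ₃ : ℝ) (Q : SO3) : IsClosed (dependentSet γ₁ γ₂ γ₃ Q) := by
  have hcay : Continuous fun v => (cay v).1 :=
    (contDiff_iff_contDiffAt.2 contDiffAt_cay).continuous
  have hR : Continuous fun v => (Q * cay v).1 := continuous_const.matrix_mul hcay
  have hA : Continuous fun v => conjBy (Q * cay v) A₀ :=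
    ((hR.matrix_map Complex.continuous_ofReal).matrix_mul continuous_const).matrix_mul
      (hR.matrix_transpose.matrix_map Complex.continuous_ofReal)
  have hJ : Continuous fun A => (inertia γ₁ γ₂ γ₃ A) :=
    (contDiff_iff_contDiffAt.2 fun A => contDiffAt_id.inertia γ₁ γ₂ γ₃ :
      ContDiff ℝ ∞ fun A => inertia γ₁ γ₂ γ₃ A).continuous
  have hz : Continuous fun v => (Q * cay v).1 *ᵥ (Pi.single 2 1 : Fin 3 → ℝ) :=
    hR.matrix_mulVec continuous_const
  have hu : Continuous fun v => crossProduct ((Q * cay v).1 *ᵥ Pi.single 2 1)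
      (Pi.single 2 1 : Fin 3 → ℝ) :=
    (LinearMap.continuous_of_finiteDimensional
      ((crossProduct (R := ℝ)).flip (Pi.single 2 1))).comp hz
  have hF : Continuous fun v => (inertia γ₁ γ₂ γ₃ (conjBy (Q * cay v) A₀)).adjugate *ᵥ
      crossProduct ((Q * cay v).1 *ᵥ Pi.single 2 1) (Pi.single 2 1) :=
    ((hJ.comp hA).matrix_adjugate).matrix_mulVec hu
  exact isClosed_eq (continuous_snd.dotProduct (hF.comp continuous_fst)) continuous_const

lemma volume_dependentSet {γ₁ γ₂ γ₃ : ℝ} (hγ₁ : 0 < γ₁) (hγ : 0 < γ₁ + γ₂ + γ₃) (Q : SO3) :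
    volume (dependentSet γ₁ γ₂ γ₃ Q) = 0 := by
  rw [Measure.volume_eq_prod, Measure.measure_prod_null (isClosed_dependentSet _ _ _ Q).measurableSet]
  have h : ∀ᵐ v : Fin 3 → ℝ, crossProduct ((Q * cay v).1 *ᵥ Pi.single 2 1) (Pi.single 2 1) ≠ 0 := by
    rw [ae_iff]
    simpa using volume_axis_vertical Q
  filter_upwards [h] with v hv
  show volume {m : Fin 3 → ℝ | m ⬝ᵥ ((inertia γ₁ γ₂ γ₃ (conjBy (Q * cay v) A₀)).adjugate *ᵥ
    crossProduct ((Q * cay v).1 *ᵥ Pi.single 2 1) (Pi.single 2 1)) = 0} = 0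
  refine volume_hyperplane fun h0 => hv ?_
  -- Multiplying by `J` turns the adjugate into the nonzero scalar `det J`, so the normal of the
  -- plane vanishes only if `z × e₃` does.
  have h1 := congrArg (fun u => inertia γ₁ γ₂ γ₃ (conjBy (Q * cay v) A₀) *ᵥ u) h0
  simp only [Matrix.mulVec_mulVec, Matrix.mul_adjugate, Matrix.smul_mulVec, Matrix.one_mulVec,
    Matrix.mulVec_zero] at h1
  exact (smul_eq_zero.1 h1).resolve_left (det_inertia_conjBy hγ₁ hγ _)

lemma isNullIn_dependent {γ₁ γ₂ γ₃ : ℝ} (hγ₁ : 0 < γ₁) (hγ : 0 < γ₁ + γ₂ + γ₃) :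
    IsNullIn ((Set.univ : Set (Fin 3 → ℝ)) ×ˢ Omega6.orbit) (2 * 3)
      {p ∈ (Set.univ : Set (Fin 3 → ℝ)) ×ˢ Omega6.orbit |
        ¬ DifferentialsIndependentAt ((Set.univ : Set (Fin 3 → ℝ)) ×ˢ Omega6.orbit)
          ![hamiltonian γ₁ γ₂ γ₃, jm γ₁ γ₂ γ₃, J₃] p} := by
  rintro ⟨m, A⟩ hp
  obtain ⟨Q, rfl⟩ := (mem_orbit_iff A).1 hp.2
  refine ⟨_, _, _, _, (isLocalParam_orbit Q).univ_prod, mem_chartTarget Q, ?_⟩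
  refine measure_mono_null ?_ (volume_splitEquiv_preimage
    (isClosed_dependentSet γ₁ γ₂ γ₃ Q).measurableSet (volume_dependentSet hγ₁ hγ Q))
  rintro u ⟨-, -, hu⟩
  by_contra h
  apply hu
  simp only [← conjBy_mul]
  exact differentialsIndependentAt_of_ne (det_inertia_conjBy hγ₁ hγ _) h

lemma isSubmanifold_prod : IsSubmanifold ((Set.univ : Set (Fin 3 → ℝ)) ×ˢ Omega6.orbit) (2 * 3) := by
  rintro ⟨m, A⟩ hp
  obtain ⟨Q, rfl⟩ := (mem_orbit_iff A).1 hp.2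
  exact ⟨_, _, _, _, (isLocalParam_orbit Q).univ_prod, mem_chartTarget Q⟩

lemma isCompletelyIntegrable {γ₁ γ₂ γ₃ : ℝ} (hγ₁ : 0 < γ₁) (hγ : 0 < γ₁ + γ₂ + γ₃) :
    IsCompletelyIntegrable ((Set.univ : Set (Fin 3 → ℝ)) ×ˢ Omega6.orbit) 3
      ![hamiltonian γ₁ γ₂ γ₃, jm γ₁ γ₂ γ₃, J₃] where
  submanifold := isSubmanifold_prod
  symplectic := fun _ hp X => symplectic_iff hp X
  smooth := fun i p hp => by
    have hd := inertia_det_ne_zero hγ₁ hγ hp.2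
    fin_cases i
    · exact contDiffAt_hamiltonian hd
    · exact contDiffAt_jm hd
    · exact contDiffAt_J₃ p
  involution := fun i j p hp => by
    obtain ⟨m, A⟩ := p
    obtain ⟨R, rfl⟩ := (mem_orbit_iff A).1 hp.2
    exact Omega6.involution hγ₁ hγ i j m R
  independent := isNullIn_dependent hγ₁ hγ

end Omega6

end

theorem theorem4p11 (γ₁ γ₂ γ₃ : ℝ) (hγ₁ : 0 < γ₁) (hγ₂ : 0 < γ₂) (hγ₃ : 0 < γ₃) :
    -- the orbit consists of the matrices `(x + iy)(x + iy)ᵀ` with `x, y` orthonormal,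
    -- all of them symmetric and traceless
    (Omega6.orbit = {A | ∃ x y : Fin 3 → ℝ, x ⬝ᵥ x = 1 ∧ y ⬝ᵥ y = 1 ∧ x ⬝ᵥ y = 0 ∧
        A = Matrix.vecMulVec (fun k => (x k : ℂ) + Complex.I * (y k : ℂ))
          (fun k => (x k : ℂ) + Complex.I * (y k : ℂ))} ∧
      Omega6.orbit ⊆ symTraceless) ∧
    -- it is diffeomorphic to `SO(3)/ℤ₂` by the map induced by `R ↦ R A₀ R⁻¹`
    (∃ e : (SO3 ⧸ Z2) ≃ Omega6.orbit, IsDiffeoFromQuotient Omega6.orbit e ∧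
      ∀ R : SO3, (e (QuotientGroup.mk R) : GL3C) = conjBy R A₀) ∧
    -- the coadjoint orbit through `(0, A₀)` is `so(3)* × orbit`
    coadjointOrbit (0, A₀) = Set.univ ×ˢ Omega6.orbit ∧
    -- the Legendre transformation is invertible over the orbit, and `h = ¼ mᵀ J(A)⁻¹ m`
    (∀ A ∈ Omega6.orbit, IsUnit (inertia γ₁ γ₂ γ₃ A).det ∧ ∀ m : Fin 3 → ℝ,
      hamiltonian γ₁ γ₂ γ₃ (m, A) =
        (1 / 4 : ℝ) * (m ⬝ᵥ ((inertia γ₁ γ₂ γ₃ A)⁻¹ *ᵥ m))) ∧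
    -- complete integrability on the six-dimensional coadjoint orbit
    IsCompletelyIntegrable (coadjointOrbit (0, A₀)) 3
      ![hamiltonian γ₁ γ₂ γ₃, jm γ₁ γ₂ γ₃, J₃] := by
  have hγ : 0 < γ₁ + γ₂ + γ₃ := by positivity
  refine ⟨⟨orbit_eq, orbit_subset_symTraceless⟩, ⟨quotientEquiv, isDiffeo_quotientEquiv,
    quotientEquiv_mk⟩, coadjointOrbit_eq, fun A hA => ?_, ?_⟩
  · have hd := inertia_det_ne_zero hγ₁ hγ hA
    exact ⟨hd.isUnit, fun m => hamiltonian_eq hd⟩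
  · rw [coadjointOrbit_eq]
    exact isCompletelyIntegrable hγ₁ hγ
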